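/- Let $N$ be a closed manifold and $V\to N$ a smooth real or complex vector bundle of finite rank. Let $\mathcal A$ be either the algebra $\Psi\mathrm{DO}_{\le 0}$ of classical pseudodifferential operators of order at most $0$ acting on the smooth sections of $V$, or the algebra $\Gamma(\mathrm{End}\,V)$ of bundle endomorphisms acting as multiplication operators. Its group of units $\mathcal A^\times$ is, respectively, the group $\mathrm{Ell}_0^*$ of invertible classical pseudodifferential operators of order $0$ (with inverse of order $0$), or the gauge group $\mathcal G$ of $V$. Let $\mathcal A$ carry a Hausdorff locally convex topology making it a topological algebra with open group of units and continuous inversion (as its usual Fréchet topology does), so that $\mathcal A^\times$ is a Lie group with Lie algebra $(\mathcal A,[\,\cdot\,,\cdot\,])$. Manifolds, smooth maps and differential forms are understood in the sense of the Michal–Bastiani calculus on Hausdorff locally convex spaces. Let $\pi:\mathcal E\to\mathcal B$ be a smooth principal $\mathcal A^\times$-bundle with connection $\theta\in\Lambda^1(\mathcal E,\mathcal A)$ and curvature $\Omega=d\theta+\tfrac12[\theta,\theta]\in\Lambda^2(\mathcal E,\mathcal A)$. Let $l\ge 1$ and let $P\in I^l(\mathcal A^\times)$, i.e. $P:\mathcal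 A^l\to\mathbb K$ ($\mathbb K=\mathbb R$ or $\mathbb C$) is a continuous, symmetric, real-multilinear map with $P(gX_1g^{-1},\dots,gX_lg^{-1})=P(X_1,\dots,X_l)$ for all $g\in\mathcal A^\times$, $X_i\in\mathcal A$. For $t\in[0,1]$ put $$\phi_t=t\,\Omega+\tfrac12(t^2-t)[\theta,\theta],\qquad TP(\theta)=l\int_0^1P(\theta\wedge\phi_t^{\,l-1})\,dt .$$ Then $TP(\theta)$ is a smooth $\mathbb K$-valued $(2l-1)$-form on $\mathcal E$ and $$d\,TP(\theta)=P(\Omega^l)\in\Lambda^{2l}(\mathcal E,\mathbb K).$$ -/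

import Mathlib

open Set Filter Topology Bundle
open scoped Manifold ContDiff Matrix

noncomputable section

/-! ## Calculus in locally convex spaces (Michal--Bastiani) -/

section Calculus

universe u

/-- The derivative of `f` at `x` in direction `v` exists and equals `w`. -/
def HasDirDeriv {E F : Type*} [AddCommGroup E] [Module ℝ E]
    [AddCommGroup F] [Module ℝ F] [TopologicalSpace F]
    (f : E → F) (x v : E) (w : F) : Prop :=
  Tendsto (fun t : ℝ => t⁻¹ • (f (x + t • v) - f x)) (𝓝[≠] 0) (𝓝 w)

/-- The directional derivative `lim_{t → 0} (f (x + t v) - f x) / t`. -/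
def dirDeriv {E F : Type*} [AddCommGroup E] [Module ℝ E]
    [AddCommGroup F] [Module ℝ F] [TopologicalSpace F]
    (f : E → F) (x v : E) : F :=
  limUnder (𝓝[≠] 0) (fun t : ℝ => t⁻¹ • (f (x + t • v) - f x))

/-- `f` is `C^k` on the open set `U` in the sense of Michal--Bastiani: `f` is continuous, all
directional derivatives exist on `U`, and `(x, v) ↦ df(x; v)` is `C^(k-1)` on `U × E`. -/
def CkOn {F : Type*} [AddCommGroup F] [Module ℝ F] [TopologicalSpace F] :
    ℕ → ∀ {E : Type u} [AddCommGroup E] [Module ℝ E] [TopologicalSpace E],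
      (E → F) → Set E → Prop
  | 0, _, _, _, _, f, U => ContinuousOn f U
  | k + 1, E, _, _, _, f, U => ContinuousOn f U ∧ ∃ df : E × E → F,
      (∀ x ∈ U, ∀ v, HasDirDeriv f x v (df (x, v))) ∧ CkOn k df (U ×ˢ univ)

/-- Smoothness on an open subset of a locally convex space. -/
def SmoothOn {E : Type u} {F : Type*} [AddCommGroup E] [Module ℝ E] [TopologicalSpace E]
    [AddCommGroup F] [Module ℝ F] [TopologicalSpace F] (f : E → F) (U : Set E) : Prop :=
  ∀ k : ℕ, CkOn k f U

end Calculus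

/-! ## Manifolds modelled on locally convex spaces, and differential forms on them

As for Mathlib's `TangentSpace`, the tangent space of `M` at `p` is the model space `E`, identified
through the preferred chart `chartAt E p`. -/

section Manifolds

instance instAddCommGroupModelProd (E F : Type*) [AddCommGroup E] [AddCommGroup F] :
    AddCommGroup (ModelProd E F) := inferInstanceAs (AddCommGroup (E × F))

instance instModuleModelProd (E F : Type*) [AddCommGroup E] [AddCommGroup F]
    [Module ℝ E] [Module ℝ F] : Module ℝ (ModelProd E F) := inferInstanceAs (Module ℝ (E × F))

variable (E : Type*) [AddCommGroup E] [Module ℝ E] [TopologicalSpace E]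
  {E' : Type*} [AddCommGroup E'] [Module ℝ E'] [TopologicalSpace E']
  (M : Type*) [TopologicalSpace M] [ChartedSpace E M]
  {M' : Type*} [TopologicalSpace M'] [ChartedSpace E' M']
  {W : Type*} [AddCommGroup W] [Module ℝ W] [TopologicalSpace W]

/-- `M` is a smooth manifold modelled on `E`: the transition maps of its atlas are smooth. -/
def IsLCManifold : Prop :=
  ∀ e ∈ atlas E M, ∀ e' ∈ atlas E M, SmoothOn (e.symm.trans e') (e.symm.trans e').source

variable (E') {M}

/-- `f : M → M'` is smooth on the open set `s`. -/
def MSmoothOn (f : M → M') (s : Set M) : Prop :=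
  ContinuousOn f s ∧ ∀ e ∈ atlas E M, ∀ e' ∈ atlas E' M',
    SmoothOn (e' ∘ f ∘ e.symm) (e.target ∩ e.symm ⁻¹' (s ∩ f ⁻¹' e'.source))

/-- The tangent map `T_p f : T_p M → T_{f p} M'`. -/
def tangentMapLC (f : M → M') (p : M) (v : E) : E' :=
  dirDeriv (chartAt E' (f p) ∘ f ∘ (chartAt E p).symm) (chartAt E p p) v

variable {E}

/-- The expression in the chart `e` of a field `α` of `k`-linear functions on the tangent spaces:
`α_e(y)(v) = α(e⁻¹ y)(T e⁻¹ v₁, …, T e⁻¹ v_k)`. -/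
def formInChart {k : ℕ} (α : M → (Fin k → E) → W) (e : OpenPartialHomeomorph M E) (y : E)
    (v : Fin k → E) : W :=
  α (e.symm y) (fun i => dirDeriv (chartAt E (e.symm y) ∘ e.symm) y (v i))

/-- `α` is a smooth `W`-valued differential `k`-form on `M`. -/
structure IsSmoothForm {k : ℕ} (α : M → (Fin k → E) → W) : Prop where
  alternating : ∀ p, ∃ β : E [⋀^Fin k]→ₗ[ℝ] W, ∀ v, α p v = β v
  smooth : ∀ e ∈ atlas E M,
    SmoothOn (fun q : E × (Fin k → E) => formInChart α e q.1 q.2) (e.target ×ˢ univ)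

/-- The exterior derivative `dα(v₀, …, v_k) = ∑ᵢ (-1)ⁱ D_{vᵢ} α(v₀, …, v̂ᵢ, …, v_k)`, computed at `p`
in the preferred chart at `p`. -/
def extDerivLC {k : ℕ} (α : M → (Fin k → E) → W) (p : M) (v : Fin (k + 1) → E) : W :=
  ∑ i : Fin (k + 1), (-1 : ℝ) ^ (i : ℕ) •
    dirDeriv (fun y => formInChart α (chartAt E p) y (i.removeNth v)) (chartAt E p p) (v i)

end Manifolds

/-! ## The Lie group of units of a locally convex algebra -/

section LieGroup

/-- A Hausdorff locally convex algebra whose units form an open set with continuous inversion, so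
that the group of units is a Lie group with Lie algebra `A` (with the commutator bracket). -/
class ContinuousInverseAlgebra (A : Type*) [Ring A] [Algebra ℝ A] [TopologicalSpace A] : Prop
    extends IsTopologicalRing A, ContinuousSMul ℝ A, LocallyConvexSpace ℝ A, T2Space A where
  isOpen_units : IsOpen {a : A | IsUnit a}
  continuousOn_inverse : ContinuousOn (Ring.inverse : A → A) {a : A | IsUnit a}

variable (A : Type*) [Ring A] [Algebra ℝ A] [TopologicalSpace A] [ContinuousInverseAlgebra A]

theorem units_isOpenEmbedding : IsOpenEmbedding (Units.val : Aˣ → A) := by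
  refine ⟨Units.isEmbedding_val_mk' ContinuousInverseAlgebra.continuousOn_inverse
    (fun u => Ring.inverse_unit u), ?_⟩
  exact ContinuousInverseAlgebra.isOpen_units

/-- The Lie group `Aˣ` as a manifold, with the inclusion `Aˣ → A` as its only chart. -/
instance instChartedSpaceUnitsLC : ChartedSpace A Aˣ :=
  (units_isOpenEmbedding A).singletonChartedSpace

end LieGroup

/-! ## Principal bundles, connections, curvature, invariant polynomials, transgression -/

section Bundles

variable (A : Type*) [Ring A] [Algebra ℝ A] [TopologicalSpace A]

/-- A smooth principal bundle `π : P → B` with structure group `Aˣ` acting on `P` from the right: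
the action preserves the fibres, and near each point of `B` there is a smooth local trivialization
`π⁻¹(U) ≅ U × Aˣ` which is equivariant. -/
structure IsPrincipalBundle [ContinuousInverseAlgebra A]
    (EB EP : Type*) [AddCommGroup EB] [Module ℝ EB] [TopologicalSpace EB]
    [AddCommGroup EP] [Module ℝ EP] [TopologicalSpace EP]
    {B P : Type*} [TopologicalSpace B] [ChartedSpace EB B]
    [TopologicalSpace P] [ChartedSpace EP P] [MulAction Aˣᵐᵒᵖ P] (proj : P → B) : Prop where
  base : IsLCManifold EB B
  total : IsLCManifold EP P
  smooth_proj : MSmoothOn EP EB proj univ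
  proj_smul : ∀ (g : Aˣ) (p : P), proj (MulOpposite.op g • p) = proj p
  locallyTrivial : ∀ b : B, ∃ Φ : Trivialization Aˣ proj, b ∈ Φ.baseSet ∧
    MSmoothOn EP (ModelProd EB A) Φ Φ.source ∧
    MSmoothOn (ModelProd EB A) EP Φ.toOpenPartialHomeomorph.symm Φ.target ∧
    ∀ p ∈ Φ.source, ∀ g : Aˣ, (Φ (MulOpposite.op g • p)).2 = (Φ p).2 * g

variable {A} {E : Type*} [AddCommGroup E] [Module ℝ E] [TopologicalSpace E]
  {P : Type*} [TopologicalSpace P] [ChartedSpace E P]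

/-- `θ` is a connection on the principal `Aˣ`-bundle with total space `P`: a smooth `A`-valued
one-form with `θ(ζ_X) = X` for the fundamental vector fields `ζ_X(p) = T_1(g ↦ p g) X`, and
`R_g^* θ = Ad(g⁻¹) θ`. -/
structure IsConnection [ContinuousInverseAlgebra A] [MulAction Aˣᵐᵒᵖ P]
    (θ : P → (Fin 1 → E) → A) : Prop where
  smooth : IsSmoothForm θ
  vertical : ∀ (p : P) (X : A),
    θ (MulOpposite.op (1 : Aˣ) • p)
      ![tangentMapLC A E (fun g : Aˣ => MulOpposite.op g • p) 1 X] = X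
  equivariant : ∀ (g : Aˣ) (p : P) (v : E),
    θ (MulOpposite.op g • p) ![tangentMapLC E E (fun q : P => MulOpposite.op g • q) p v]
      = ((g⁻¹ : Aˣ) : A) * θ p ![v] * (g : A)

/-- The two-form `[θ, θ]`; so `[θ, θ](v₀, v₁) = [θ v₀, θ v₁] - [θ v₁, θ v₀] = 2 [θ v₀, θ v₁]`. -/
def bracketForm (θ : P → (Fin 1 → E) → A) : P → (Fin 2 → E) → A :=
  fun p v => ⁅θ p ![v 0], θ p ![v 1]⁆ - ⁅θ p ![v 1], θ p ![v 0]⁆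

/-- The curvature `Ω = dθ + ½ [θ, θ]`. -/
def curvatureForm (θ : P → (Fin 1 → E) → A) : P → (Fin 2 → E) → A :=
  fun p v => extDerivLC θ p v + (1 / 2 : ℝ) • bracketForm θ p v

/-- `φ_t = t Ω + ½ (t² - t) [θ, θ]`. -/
def phiForm (θ : P → (Fin 1 → E) → A) (t : ℝ) : P → (Fin 2 → E) → A :=
  fun p v => t • curvatureForm θ p v + (1 / 2 * (t ^ 2 - t) : ℝ) • bracketForm θ p v

/-- `Q ∈ I^l(Aˣ)`: a symmetric continuous `l`-linear function on the Lie algebra `A` which is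
invariant under the adjoint action of `Aˣ`. -/
structure IsInvariantPolynomial {l : ℕ} {𝕂 : Type*} [RCLike 𝕂]
    (Q : ContinuousMultilinearMap ℝ (fun _ : Fin l => A) 𝕂) : Prop where
  symmetric : ∀ (σ : Equiv.Perm (Fin l)) (X : Fin l → A), Q (X ∘ σ) = Q X
  invariant : ∀ (g : Aˣ) (X : Fin l → A),
    Q (fun i => (g : A) * X i * ((g⁻¹ : Aˣ) : A)) = Q X

variable {m : ℕ} {𝕂 : Type*} [RCLike 𝕂]

/-- `Q(φ ∧ ⋯ ∧ φ)` for an `A`-valued two-form `φ`. The wedge product is normalized as usual: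
`Q(ψ₁ ∧ ⋯ ∧ ψ_l) = (k₁! ⋯ k_l!)⁻¹ ∑_σ sign(σ) Q(ψ₁(v_σ…), …, ψ_l(…v_σ))` for forms of degrees
`k₁, …, k_l`. -/
def polyPow (Q : ContinuousMultilinearMap ℝ (fun _ : Fin (m + 1) => A) 𝕂)
    (φ : P → (Fin 2 → E) → A) : P → (Fin (2 * m + 1 + 1) → E) → 𝕂 :=
  fun p v => ((2 : ℝ) ^ (m + 1))⁻¹ • ∑ σ : Equiv.Perm (Fin (2 * m + 1 + 1)),
    ((Equiv.Perm.sign σ : ℤ) : ℝ) • Q (fun i : Fin (m + 1) =>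
      φ p ![v (σ ⟨2 * i, by omega⟩), v (σ ⟨2 * i + 1, by omega⟩)])

/-- `Q(θ ∧ φ ∧ ⋯ ∧ φ)` (with `m` factors `φ`) for an `A`-valued one-form `θ` and an `A`-valued
two-form `φ`, with the same normalization. -/
def polyOnePow (Q : ContinuousMultilinearMap ℝ (fun _ : Fin (m + 1) => A) 𝕂)
    (θ : P → (Fin 1 → E) → A) (φ : P → (Fin 2 → E) → A) : P → (Fin (2 * m + 1) → E) → 𝕂 :=
  fun p v => ((2 : ℝ) ^ m)⁻¹ • ∑ σ : Equiv.Perm (Fin (2 * m + 1)),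
    ((Equiv.Perm.sign σ : ℤ) : ℝ) • Q (Fin.cons (θ p ![v (σ 0)]) (fun i : Fin m =>
      φ p ![v (σ ⟨2 * i + 1, by omega⟩), v (σ ⟨2 * i + 2, by omega⟩)]))

/-- The transgression form `TQ(θ) = l ∫₀¹ Q(θ ∧ φ_t^{l-1}) dt`, where `l = m + 1`. -/
def transgressionForm (Q : ContinuousMultilinearMap ℝ (fun _ : Fin (m + 1) => A) 𝕂)
    (θ : P → (Fin 1 → E) → A) : P → (Fin (2 * m + 1) → E) → 𝕂 :=
  fun p v => ((m + 1 : ℕ) : ℝ) • ∫ t in (0 : ℝ)..1, polyOnePow Q θ (phiForm θ t) p v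

end Bundles

/-! ## Classical pseudodifferential operators of order at most zero -/

section Symbols

variable {n r : ℕ}

/-- The symbol estimates of order `d` on `{‖ξ‖ ≥ R}`, uniformly in `x`. -/
def SymbolEstimate (d : ℤ) (R : ℝ)
    (a : EuclideanSpace ℝ (Fin n) → EuclideanSpace ℝ (Fin n) → ℂ) : Prop :=
  ∀ k j : ℕ, ∃ C : ℝ, ∀ x ξ, R ≤ ‖ξ‖ →
    ‖iteratedFDeriv ℝ j (fun η => iteratedFDeriv ℝ k (fun z => a z η) x) ξ‖
      ≤ C * (1 + ‖ξ‖) ^ (d - j)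

/-- `a` is a classical symbol of order `0` (hence possibly of lower order): it has an asymptotic
expansion `a ∼ h₀ + h₁ + ⋯` with `h_j(x, ξ)` positively homogeneous of degree `-j` in `ξ ≠ 0`. -/
def IsClassicalSymbol
    (a : EuclideanSpace ℝ (Fin n) → EuclideanSpace ℝ (Fin n) → ℂ) : Prop :=
  ContDiff ℝ ∞ (fun q : EuclideanSpace ℝ (Fin n) × EuclideanSpace ℝ (Fin n) => a q.1 q.2) ∧
  SymbolEstimate 0 0 a ∧
  ∃ h : ℕ → EuclideanSpace ℝ (Fin n) → EuclideanSpace ℝ (Fin n) → ℂ,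
    (∀ j, ContDiffOn ℝ ∞
      (fun q : EuclideanSpace ℝ (Fin n) × EuclideanSpace ℝ (Fin n) => h j q.1 q.2)
      {q | q.2 ≠ 0}) ∧
    (∀ j x ξ, ξ ≠ 0 → ∀ c : ℝ, 0 < c → h j x (c • ξ) = ((c ^ (-(j : ℤ)) : ℝ) : ℂ) * h j x ξ) ∧
    ∀ J : ℕ, SymbolEstimate (-(J : ℤ)) 1 (fun x ξ => a x ξ - ∑ j ∈ Finset.range J, h j x ξ)

/-- The quantization `Op(a) u (x) = (2π)⁻ⁿ ∫ e^{i⟨x, ξ⟩} a(x, ξ) ∫ e^{-i⟨z, ξ⟩} u(z) dz dξ`. -/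
def pseudoOp (a : EuclideanSpace ℝ (Fin n) → EuclideanSpace ℝ (Fin n) → Matrix (Fin r) (Fin r) ℂ)
    (u : EuclideanSpace ℝ (Fin n) → Fin r → ℂ) (x : EuclideanSpace ℝ (Fin n)) : Fin r → ℂ :=
  (((2 * Real.pi) ^ n)⁻¹ : ℝ) • ∫ ξ : EuclideanSpace ℝ (Fin n),
    Complex.exp (Complex.I * (inner ℝ x ξ : ℝ)) •
      (a x ξ *ᵥ ∫ z : EuclideanSpace ℝ (Fin n),
        Complex.exp (-(Complex.I * (inner ℝ z ξ : ℝ))) • u z)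

end Symbols

section PseudoDifferential

variable {n r : ℕ} {𝕜 : Type*} [RCLike 𝕜]
  {N : Type*} [TopologicalSpace N] [ChartedSpace (EuclideanSpace ℝ (Fin n)) N]
  {V : N → Type*} [TopologicalSpace (TotalSpace (Fin r → 𝕜) V)]
  [∀ x, TopologicalSpace (V x)] [FiberBundle (Fin r → 𝕜) V]

/-- The expression of a section of `V` (real or complex of rank `r`) in a chart `e` of `N` and a
trivialization `T` of `V`, as a `ℂ^r`-valued function, extended by zero. -/
def localRep (e : OpenPartialHomeomorph N (EuclideanSpace ℝ (Fin n)))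
    (T : Trivialization (Fin r → 𝕜) (π (Fin r → 𝕜) V)) (s : ∀ x, V x)
    (y : EuclideanSpace ℝ (Fin n)) (i : Fin r) : ℂ :=
  open Classical in
  if y ∈ e.target ∧ e.symm y ∈ T.baseSet then
    RCLike.map 𝕜 ℂ ((T ⟨e.symm y, s (e.symm y)⟩).2 i)
  else 0

variable [∀ x, AddCommGroup (V x)] [∀ x, Module ℝ (V x)] [VectorBundle ℝ (Fin r → 𝕜) V]

/-- The product of a smooth function and a smooth section. -/
def cutSection (ψ : C^∞⟮𝓡 n, N; 𝓘(ℝ, ℝ), ℝ⟯) (s : Cₛ^∞⟮𝓡 n; Fin r → 𝕜, V⟯) :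
    Cₛ^∞⟮𝓡 n; Fin r → 𝕜, V⟯ :=
  ⟨fun x => ψ x • s x, ψ.contMDiff.smul_section s.contMDiff⟩

variable [∀ x, Module 𝕜 (V x)]

/-- `D` is a classical pseudodifferential operator of order at most zero on smooth sections of the
`𝕜`-vector bundle `V → N`: it is `𝕜`-linear, for all cutoff functions `φ`, `ψ` supported in the
domain of a chart and a trivialization `φ D ψ` is given there by a (complex) matrix-valued classical
symbol of order zero, and for `φ`, `ψ` with disjoint supports `φ D ψ` has a smooth kernel. -/
structure IsClassicalPsiDO
    (D : Module.End ℝ Cₛ^∞⟮𝓡 n; Fin r → 𝕜, V⟯) : Prop where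
  linear : ∀ (c : 𝕜) (s s' : Cₛ^∞⟮𝓡 n; Fin r → 𝕜, V⟯),
    (∀ x, s' x = c • s x) → ∀ x, D s' x = c • D s x
  symbol : ∀ e ∈ atlas (EuclideanSpace ℝ (Fin n)) N,
    ∀ T ∈ FiberBundle.trivializationAtlas (Fin r → 𝕜) V,
    ∀ φ ψ : C^∞⟮𝓡 n, N; 𝓘(ℝ, ℝ), ℝ⟯,
      tsupport φ ⊆ e.source ∩ T.baseSet → tsupport ψ ⊆ e.source ∩ T.baseSet →
      ∃ a : EuclideanSpace ℝ (Fin n) → EuclideanSpace ℝ (Fin n) → Matrix (Fin r) (Fin r) ℂ,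
        (∀ i j, IsClassicalSymbol (fun x ξ => a x ξ i j)) ∧
        ∀ s, localRep e T (cutSection φ (D (cutSection ψ s)))
          = pseudoOp a (localRep e T (cutSection ψ s))
  kernel : ∀ e ∈ atlas (EuclideanSpace ℝ (Fin n)) N,
    ∀ e' ∈ atlas (EuclideanSpace ℝ (Fin n)) N,
    ∀ T ∈ FiberBundle.trivializationAtlas (Fin r → 𝕜) V,
    ∀ T' ∈ FiberBundle.trivializationAtlas (Fin r → 𝕜) V,
    ∀ φ ψ : C^∞⟮𝓡 n, N; 𝓘(ℝ, ℝ), ℝ⟯,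
      tsupport φ ⊆ e.source ∩ T.baseSet → tsupport ψ ⊆ e'.source ∩ T'.baseSet →
      Disjoint (tsupport φ) (tsupport ψ) →
      ∃ K : EuclideanSpace ℝ (Fin n) → EuclideanSpace ℝ (Fin n) → Matrix (Fin r) (Fin r) ℂ,
        (∀ i j, ContDiff ℝ ∞
          (fun q : EuclideanSpace ℝ (Fin n) × EuclideanSpace ℝ (Fin n) => K q.1 q.2 i j)) ∧
        ∀ s y, localRep e T (cutSection φ (D (cutSection ψ s))) y
          = ∫ z, K y z *ᵥ localRep e' T' (cutSection ψ s) z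

variable (n r 𝕜 V)

/-- The algebra `ΨDO_{≤0}` of classical pseudodifferential operators of order at most zero on
sections of `V`. These operators are closed under sums, scalar multiples and products, so the
algebra they generate is the set of these operators. Its group of units, the operators with an
inverse of the same kind, is `Ell₀^*`, and its Lie algebra is `ΨDO_{≤0}`. -/
def psiDOAlgebra : Subalgebra ℝ (Module.End ℝ Cₛ^∞⟮𝓡 n; Fin r → 𝕜, V⟯) :=
  Algebra.adjoin ℝ {D | IsClassicalPsiDO D}

/-- The algebra `Γ(End V)` of bundle endomorphisms of `V`, acting on sections of `V` as
multiplication operators. Its group of units is the gauge group of `V`. -/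
def gaugeAlgebra [∀ x, IsScalarTower ℝ 𝕜 (V x)] :
    Subalgebra ℝ (Module.End ℝ Cₛ^∞⟮𝓡 n; Fin r → 𝕜, V⟯) where
  carrier := {D | ∃ a : ∀ x, V x →ₗ[𝕜] V x, ∀ s x, D s x = a x (s x)}
  mul_mem' := by
    rintro D D' ⟨a, ha⟩ ⟨b, hb⟩
    exact ⟨fun x => a x ∘ₗ b x, fun s x => by
      rw [Module.End.mul_apply, ha, hb, LinearMap.comp_apply]⟩
  add_mem' := by
    rintro D D' ⟨a, ha⟩ ⟨b, hb⟩
    exact ⟨fun x => a x + b x, fun s x => by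
      rw [LinearMap.add_apply, ContMDiffSection.coe_add, Pi.add_apply, ha, hb,
        LinearMap.add_apply]⟩
  algebraMap_mem' := by
    intro c
    refine ⟨fun x => (algebraMap ℝ 𝕜 c) • LinearMap.id, fun s x => ?_⟩
    rw [Module.algebraMap_end_apply, ContMDiffSection.coe_smul, Pi.smul_apply,
      LinearMap.smul_apply, LinearMap.id_apply, algebraMap_smul]

end PseudoDifferential

end

/-!
Only local computations enter, and the structure group only through its Lie algebra `A`. Fix a chart
and a point, and write `T = θ`, `S(u, w) = D_u θ(w)` and `R(x, u, w) = D_x D_u θ(w)`. The form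
`φ_t` is the curvature of `tθ`, that is, `φ_t = t dθ + ½ t² [θ, θ]`.

* By invariance of `Q` and the Bianchi identity `dφ_t = -t [θ, φ_t]`, the exterior derivative of
  `Q(θ ∧ φ_t^m)` equals `Q(φ_t' ∧ φ_t^m)`, where `φ_t' = dθ + t [θ, θ]` is the derivative in `t`
  (`altSum_deriv_transgression`). With wedge products written as alternating sums, the Bianchi
  identity is the statement that two functions of three vectors have the same antisymmetrization
  (`antisymm3_bianchi`): this uses the symmetry of `R` in its first two arguments and the Jacobi
  identity. Invariance is used in its infinitesimal form, which follows from
  `Q(gY₁, …, gY_l) = Q(Y₁g, …, Y_l g)` with `g = 1 + sX`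
  (`IsInvariantPolynomial.sum_bracket_eq_zero`).
* By symmetry of `Q`, `l Q(φ_t' ∧ φ_t^m)` is the derivative of `Q(φ_t^l)` in `t`. Integrating from
  `φ_0 = 0` to `φ_1 = Ω` gives `Q(Ω^l)` (`integral_altSum_scaledCurvatureDeriv`).

The integrand `Q(θ ∧ φ_t^m)` is a polynomial in `t`, so the transgression form is a finite linear
combination of polynomials in `θ` and `dθ` (`formInChart_transgressionForm_eq_sum`). This gives its
smoothness and differentiation under the integral without any completeness of `A`.

The exterior derivative is defined pointwise in preferred charts, hence `dθ` has to be shown to have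
the same expression in every chart (`formInChart_extDerivLC`). The term with the second derivative
of the change of charts cancels by Schwarz's theorem. In the Michal--Bastiani setting, the chain
rule, additivity of the derivative and Schwarz's theorem all come from a mean value theorem for
closed convex sets, obtained from the Hahn--Banach theorem (`sub_mem_of_hasDirDeriv_mem`). It makes
the derivative strict, i.e. difference quotients converge also for varying base point and direction
(`hasStrictDirDeriv_of_continuousAt`).
-/

/-! ### Directional derivatives in locally convex spaces -/

section DirectionalDerivatives

variable {E F G : Type*} [AddCommGroup E] [Module ℝ E]
  [AddCommGroup F] [Module ℝ F] [TopologicalSpace F]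
  [AddCommGroup G] [Module ℝ G] [TopologicalSpace G]

theorem HasDirDeriv.dirDeriv_eq [T2Space F] {f : E → F} {x v : E} {w : F}
    (h : HasDirDeriv f x v w) : dirDeriv f x v = w :=
  Tendsto.limUnder_eq h

theorem HasDirDeriv.unique [T2Space F] {f : E → F} {x v : E} {w w' : F}
    (h : HasDirDeriv f x v w) (h' : HasDirDeriv f x v w') : w = w' :=
  tendsto_nhds_unique h h'

theorem tendsto_line [TopologicalSpace E] [ContinuousAdd E] [ContinuousSMul ℝ E] (x v : E) :
    Tendsto (fun t : ℝ => x + t • v) (𝓝 0) (𝓝 x) := by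
  have h : Continuous fun t : ℝ => x + t • v := by fun_prop
  simpa using h.tendsto 0

theorem HasDirDeriv.congr_of_eventuallyEq [TopologicalSpace E] [ContinuousAdd E]
    [ContinuousSMul ℝ E] {f g : E → F} {x v : E} {w : F} (h : HasDirDeriv f x v w)
    (hfg : g =ᶠ[𝓝 x] f) : HasDirDeriv g x v w := by
  refine Tendsto.congr' ?_ h
  have h1 := ((tendsto_line x v).mono_left nhdsWithin_le_nhds).eventually hfg
    (l₁ := 𝓝[≠] (0 : ℝ))
  filter_upwards [h1] with t ht
  rw [ht, hfg.self_of_nhds]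

theorem hasDirDeriv_id [TopologicalSpace E] (x v : E) : HasDirDeriv (fun y : E => y) x v v := by
  refine Tendsto.congr' ?_ tendsto_const_nhds
  filter_upwards [self_mem_nhdsWithin] with t (ht : t ≠ 0)
  rw [add_sub_cancel_left, inv_smul_smul₀ ht]

theorem hasDirDeriv_zero_dir (f : E → F) (x : E) : HasDirDeriv f x 0 (0 : F) := by
  simpa [HasDirDeriv] using tendsto_const_nhds

theorem HasDirDeriv.smul_dir [ContinuousSMul ℝ F] {f : E → F} {x v : E} {w : F}
    (h : HasDirDeriv f x v w) (c : ℝ) : HasDirDeriv f x (c • v) (c • w) := by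
  rcases eq_or_ne c 0 with rfl | hc
  · simpa using hasDirDeriv_zero_dir f x
  have h1 : Tendsto (fun t : ℝ => t * c) (𝓝[≠] 0) (𝓝[≠] 0) := by
    refine tendsto_nhdsWithin_of_tendsto_nhds_of_eventually_within _ ?_ ?_
    · have : Tendsto (fun t : ℝ => t * c) (𝓝 0) (𝓝 (0 * c)) :=
        (continuous_id.mul continuous_const).tendsto 0
      rw [zero_mul] at this
      exact this.mono_left nhdsWithin_le_nhds
    · filter_upwards [self_mem_nhdsWithin] with t ht
      exact mul_ne_zero ht hc
  refine ((h.comp h1).const_smul c).congr fun t => ?_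
  simp only [Function.comp_apply, smul_smul, mul_inv_rev]
  rw [mul_inv_cancel_left₀ hc]

theorem HasDirDeriv.tendsto_line [ContinuousAdd F] [ContinuousSMul ℝ F] {f : E → F} {x v : E}
    {w : F} (h : HasDirDeriv f x v w) :
    Tendsto (fun t : ℝ => f (x + t • v)) (𝓝[≠] 0) (𝓝 (f x)) := by
  have h1 : Tendsto (fun t : ℝ => t) (𝓝[≠] 0) (𝓝 0) := tendsto_id.mono_left nhdsWithin_le_nhds
  have h2 := (h1.smul h).const_add (f x)
  rw [zero_smul, add_zero] at h2
  refine h2.congr' ?_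
  filter_upwards [self_mem_nhdsWithin] with t (ht : t ≠ 0)
  rw [smul_inv_smul₀ ht, add_sub_cancel]

theorem HasDirDeriv.clm_comp {f : E → F} {x v : E} {w : F} (h : HasDirDeriv f x v w)
    (L : F →L[ℝ] G) : HasDirDeriv (fun y => L (f y)) x v (L w) := by
  refine ((L.continuous.tendsto w).comp h).congr fun t => ?_
  simp

theorem HasDirDeriv.add [ContinuousAdd F] {f g : E → F} {x v : E} {w w' : F}
    (h : HasDirDeriv f x v w) (h' : HasDirDeriv g x v w') :
    HasDirDeriv (fun y => f y + g y) x v (w + w') := by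
  refine (Tendsto.add h h').congr fun t => ?_
  rw [← smul_add]; beta_reduce; congr 1; abel

theorem HasDirDeriv.const_smul [ContinuousConstSMul ℝ F] {f : E → F} {x v : E} {w : F}
    (h : HasDirDeriv f x v w) (c : ℝ) : HasDirDeriv (fun y => c • f y) x v (c • w) := by
  refine (Tendsto.const_smul h c).congr fun t => ?_
  rw [smul_comm, smul_sub]

theorem hasDirDeriv_const (c : F) (x v : E) : HasDirDeriv (fun _ : E => c) x v 0 := by
  simpa [HasDirDeriv] using tendsto_const_nhds

theorem HasDirDeriv.sum [ContinuousAdd F] {ι : Type*} (s : Finset ι) {f : ι → E → F} {x v : E}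
    {w : ι → F} (h : ∀ i ∈ s, HasDirDeriv (f i) x v (w i)) :
    HasDirDeriv (fun y => ∑ i ∈ s, f i y) x v (∑ i ∈ s, w i) := by
  classical
  induction s using Finset.induction_on with
  | empty => simpa using hasDirDeriv_const (0 : F) x v
  | insert a s ha ih =>
    simp only [Finset.sum_insert ha]
    exact (h a (Finset.mem_insert_self a s)).add
      (ih fun i hi => h i (Finset.mem_insert_of_mem hi))

theorem HasDirDeriv.prodMk {f : E → F} {g : E → G} {x v : E} {w : F} {w' : G}
    (h : HasDirDeriv f x v w) (h' : HasDirDeriv g x v w') :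
    HasDirDeriv (fun y => (f y, g y)) x v (w, w') :=
  Tendsto.prodMk_nhds h h'

/-- A continuous multilinear map satisfies the Leibniz rule. The difference
`Q(a + tw) - Q(a)` is telescoped, changing one argument at a time. -/
theorem HasDirDeriv.multilinear {ι : Type*} [Fintype ι] [DecidableEq ι] [IsTopologicalAddGroup F]
    [ContinuousSMul ℝ F] [IsTopologicalAddGroup G]
    (Q : ContinuousMultilinearMap ℝ (fun _ : ι => F) G) {f : ι → E → F} {x v : E} {w : ι → F}
    (h : ∀ i, HasDirDeriv (f i) x v (w i)) :
    HasDirDeriv (fun y => Q (fun i => f i y)) x v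
      (∑ i, Q (Function.update (fun i => f i x) i (w i))) := by
  -- `s` is the set of indices whose argument has already been moved along the line
  have key : ∀ s : Finset ι, Tendsto (fun t : ℝ => t⁻¹ •
      (Q (s.piecewise (fun i => f i (x + t • v)) (fun i => f i x)) - Q (fun i => f i x)))
      (𝓝[≠] 0) (𝓝 (∑ i ∈ s, Q (Function.update (fun i => f i x) i (w i)))) := by
    intro s
    induction s using Finset.induction_on with
    | empty => simpa using tendsto_const_nhds
    | insert j s hj ih =>
      rw [Finset.sum_insert hj]
      have h1 : Tendsto (fun t : ℝ => Function.update
          (s.piecewise (fun i => f i (x + t • v)) (fun i => f i x)) j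
            (t⁻¹ • (f j (x + t • v) - f j x)))
          (𝓝[≠] 0) (𝓝 (Function.update (fun i => f i x) j (w j))) := by
        refine Tendsto.update (tendsto_pi_nhds.2 fun i => ?_) j (h j)
        by_cases hi : i ∈ s
        · simpa [Finset.piecewise, hi] using (h i).tendsto_line
        · simpa [Finset.piecewise, hi] using tendsto_const_nhds
      refine (((Q.cont.tendsto _).comp h1).add ih).congr fun t => ?_
      have h2 : Function.update (s.piecewise (fun i => f i (x + t • v)) (fun i => f i x)) j
          (f j x) = s.piecewise (fun i => f i (x + t • v)) (fun i => f i x) := by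
        rw [Function.update_eq_self_iff]; simp [hj]
      have h3 := Q.map_update_sub
        (s.piecewise (fun i => f i (x + t • v)) (fun i => f i x)) j (f j (x + t • v)) (f j x)
      rw [h2] at h3
      have h4 := Q.map_update_smul
        (s.piecewise (fun i => f i (x + t • v)) (fun i => f i x)) j t⁻¹ (f j (x + t • v) - f j x)
      rw [h3] at h4
      simp only [Function.comp_apply, Finset.piecewise_insert]
      refine (congrArg (· + _) h4).trans ?_
      rw [← smul_add]; congr 1; abel
  simpa [HasDirDeriv] using key Finset.univ

theorem HasDirDeriv.mul {A : Type*} [Ring A] [Algebra ℝ A] [TopologicalSpace A]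
    [IsTopologicalRing A] [ContinuousSMul ℝ A] {f g : E → A} {x v : E} {w w' : A}
    (h : HasDirDeriv f x v w) (h' : HasDirDeriv g x v w') :
    HasDirDeriv (fun y => f y * g y) x v (w * g x + f x * w') := by
  refine ((Tendsto.mul_const (g x) h).add (Tendsto.mul h.tendsto_line h')).congr fun t => ?_
  rw [smul_mul_assoc, mul_smul_comm, ← smul_add]; congr 1; noncomm_ring

theorem HasDirDeriv.lie {A : Type*} [Ring A] [Algebra ℝ A] [TopologicalSpace A]
    [IsTopologicalRing A] [ContinuousSMul ℝ A] {f g : E → A} {x v : E} {w w' : A}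
    (h : HasDirDeriv f x v w) (h' : HasDirDeriv g x v w') :
    HasDirDeriv (fun y => ⁅f y, g y⁆) x v (⁅w, g x⁆ + ⁅f x, w'⁆) := by
  have := (h.mul h').add ((h'.mul h).const_smul (-1))
  convert this using 1
  · funext y; rw [Ring.lie_def, neg_one_smul, sub_eq_add_neg]
  · simp only [Ring.lie_def, neg_one_smul]; abel

/-- The difference quotients of `f` at `x` in the direction `v` converge to `w` even when the base
point and the direction vary. -/
def HasStrictDirDeriv [TopologicalSpace E] (f : E → F) (x v : E) (w : F) : Prop :=
  Tendsto (fun q : ℝ × E × E => q.1⁻¹ • (f (q.2.1 + q.1 • q.2.2) - f q.2.1))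
    (𝓝[≠] 0 ×ˢ (𝓝 x ×ˢ 𝓝 v)) (𝓝 w)

theorem HasStrictDirDeriv.hasDirDeriv [TopologicalSpace E] {f : E → F} {x v : E} {w : F}
    (h : HasStrictDirDeriv f x v w) : HasDirDeriv f x v w :=
  h.comp (tendsto_id.prodMk (tendsto_const_nhds.prodMk tendsto_const_nhds))

/-- The chain rule along a line. -/
theorem HasStrictDirDeriv.comp_hasDirDeriv [IsTopologicalAddGroup F] [ContinuousSMul ℝ F]
    {g : F → G} {f : E → F} {x v : E} {w : F} {z : G}
    (hg : HasStrictDirDeriv g (f x) w z) (hf : HasDirDeriv f x v w) :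
    HasDirDeriv (fun y => g (f y)) x v z := by
  refine (hg.comp (tendsto_id.prodMk (tendsto_const_nhds.prodMk hf))).congr' ?_
  filter_upwards [self_mem_nhdsWithin] with t (ht : t ≠ 0)
  simp [smul_inv_smul₀ ht]

/-- The directional derivative is additive in the direction at points of strict
differentiability. -/
theorem HasStrictDirDeriv.add_dir [TopologicalSpace E] [IsTopologicalAddGroup E]
    [ContinuousSMul ℝ E] [ContinuousAdd F] {f : E → F} {x v v' : E} {w w' : F}
    (h : HasStrictDirDeriv f x v w) (h' : HasDirDeriv f x v' w') :
    HasDirDeriv f x (v + v') (w + w') := by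
  have h1 : Tendsto (fun t : ℝ => x + t • v') (𝓝[≠] 0) (𝓝 x) :=
    (tendsto_line x v').mono_left nhdsWithin_le_nhds
  have h2 := h.comp (tendsto_id.prodMk (h1.prodMk (tendsto_const_nhds (x := v))))
  refine (h2.add h').congr fun t => ?_
  simp only [Function.comp_apply, id]
  rw [← smul_add, smul_add t v v', add_comm (t • v), add_assoc]
  congr 1; abel

/-- The mean value theorem: if the derivative of a curve stays in a closed convex set, so does
the increment over the unit interval. A functional separating the increment from the set would
contradict the scalar mean value theorem. -/
theorem sub_mem_of_hasDirDeriv_mem [IsTopologicalAddGroup F] [ContinuousSMul ℝ F]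
    [LocallyConvexSpace ℝ F] {γ γ' : ℝ → F} {C : Set F} (hC : Convex ℝ C) (hC' : IsClosed C)
    (hγ : ∀ s ∈ Icc (0 : ℝ) 1, HasDirDeriv γ s 1 (γ' s)) (hmem : ∀ s ∈ Icc (0 : ℝ) 1, γ' s ∈ C) :
    γ 1 - γ 0 ∈ C := by
  by_contra hn
  obtain ⟨φ, u, h1, h2⟩ := geometric_hahn_banach_closed_point hC hC' hn
  have hd : ∀ s ∈ Icc (0 : ℝ) 1, HasDerivAt (fun s => φ (γ s)) (φ (γ' s)) s := by
    intro s hs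
    rw [hasDerivAt_iff_tendsto_slope_zero]
    simpa [HasDirDeriv] using (hγ s hs).clm_comp φ
  obtain ⟨c, hc, hc'⟩ := exists_hasDerivAt_eq_slope (fun s => φ (γ s)) (fun s => φ (γ' s))
    zero_lt_one (fun s hs => (hd s hs).continuousAt.continuousWithinAt)
    (fun s hs => hd s (Ioo_subset_Icc_self hs))
  have h3 := h1 _ (hmem c (Ioo_subset_Icc_self hc))
  rw [hc', sub_zero, div_one, ← map_sub] at h3
  exact lt_asymm h2 h3

/-- In a locally convex space, convergence can be tested on closed convex neighbourhoods. -/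
theorem tendsto_of_closed_convex {α : Type*} [IsTopologicalAddGroup F] [ContinuousSMul ℝ F]
    [LocallyConvexSpace ℝ F] {l : Filter α} {f : α → F} {y : F}
    (h : ∀ C ∈ 𝓝 y, Convex ℝ C → IsClosed C → ∀ᶠ a in l, f a ∈ C) : Tendsto f l (𝓝 y) := by
  intro U hU
  obtain ⟨K, hK, hK', hKU⟩ := exists_mem_nhds_isClosed_subset hU
  obtain ⟨C, ⟨hC1, hC2⟩, hC3⟩ := (LocallyConvexSpace.convex_basis (𝕜 := ℝ) y).mem_iff.1 hK
  refine (h (closure C) (mem_of_superset hC1 subset_closure) hC2.closure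
    isClosed_closure).mono fun a ha => hKU ?_
  exact closure_minimal hC3 hK' ha

theorem hasDirDeriv_line {f : E → F} {x v : E} {s t : ℝ} {w : F} [ContinuousSMul ℝ F]
    (h : HasDirDeriv f (x + (s * t) • v) v w) :
    HasDirDeriv (fun s : ℝ => f (x + (s * t) • v)) s 1 (t • w) := by
  refine (h.smul_dir t).congr fun r => ?_
  simp only [smul_eq_mul, mul_one, add_mul, add_smul, mul_smul, add_assoc]

/-- If the directional derivative exists near `x` and is jointly continuous at `(x, v)`, then it is
strict. -/
theorem hasStrictDirDeriv_of_continuousAt [TopologicalSpace E] [IsTopologicalAddGroup E]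
    [ContinuousSMul ℝ E] [IsTopologicalAddGroup F] [ContinuousSMul ℝ F]
    [LocallyConvexSpace ℝ F] {f : E → F} {df : E × E → F} {x v : E}
    (hf : ∀ᶠ y in 𝓝 x, ∀ u, HasDirDeriv f y u (df (y, u))) (hdf : ContinuousAt df (x, v)) :
    HasStrictDirDeriv f x v (df (x, v)) := by
  refine tendsto_of_closed_convex fun C hC hconv hclosed => ?_
  have hc : Continuous fun z : (ℝ × E × E) × ℝ =>
      (z.1.2.1 + (z.2 * z.1.1) • z.1.2.2, z.1.2.2) := by fun_prop
  -- by compactness of `[0, 1]`, the derivative lies in `C` along short segments near `x`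
  have key : ∀ᶠ q : ℝ × E × E in 𝓝 (0, x, v), ∀ s ∈ Icc (0 : ℝ) 1,
      (∀ u, HasDirDeriv f (q.2.1 + (s * q.1) • q.2.2) u
        (df (q.2.1 + (s * q.1) • q.2.2, u))) ∧
      df (q.2.1 + (s * q.1) • q.2.2, q.2.2) ∈ C := by
    refine isCompact_Icc.eventually_forall_of_forall_eventually fun s _ => ?_
    have h0 := hc.tendsto ((0, x, v), s)
    simp only [mul_zero, zero_smul, add_zero] at h0
    have h1 := (continuous_fst.tendsto (x, v)).comp h0
    exact (h1.eventually hf).and (h0.eventually (hdf.eventually hC))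
  have hle : 𝓝[≠] (0 : ℝ) ×ˢ (𝓝 x ×ˢ 𝓝 v) ≤ 𝓝 (0, x, v) := by
    rw [nhds_prod_eq, nhds_prod_eq]
    exact Filter.prod_mono nhdsWithin_le_nhds le_rfl
  have hne : ∀ᶠ q : ℝ × E × E in 𝓝[≠] (0 : ℝ) ×ˢ (𝓝 x ×ˢ 𝓝 v), q.1 ≠ 0 :=
    tendsto_fst.eventually self_mem_nhdsWithin
  filter_upwards [hle key, hne] with ⟨t, y, u⟩ hq ht
  have hγ : ∀ s ∈ Icc (0 : ℝ) 1, HasDirDeriv (fun s : ℝ => t⁻¹ • f (y + (s * t) • u)) s 1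
      (df (y + (s * t) • u, u)) := by
    intro s hs
    have := (hasDirDeriv_line ((hq s hs).1 u)).const_smul t⁻¹
    rwa [inv_smul_smul₀ ht] at this
  have := sub_mem_of_hasDirDeriv_mem hconv hclosed hγ fun s hs => (hq s hs).2
  simpa [smul_sub] using this

/-- Second difference quotients: if `D_u f` exists near `x` and has the strict derivative `c` at
`x` in the direction `w`, then the second differences divided by `t²` converge to `c`. -/
theorem tendsto_second_difference [TopologicalSpace E] [IsTopologicalAddGroup E]
    [ContinuousSMul ℝ E] [IsTopologicalAddGroup F] [ContinuousSMul ℝ F]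
    [LocallyConvexSpace ℝ F] {f g : E → F} {x u w : E} {c : F}
    (hf : ∀ᶠ y in 𝓝 x, HasDirDeriv f y u (g y)) (hg : HasStrictDirDeriv g x w c) :
    Tendsto (fun t : ℝ => (t⁻¹ * t⁻¹) •
      (f (x + t • u + t • w) - f (x + t • u) - (f (x + t • w) - f x))) (𝓝[≠] 0) (𝓝 c) := by
  refine tendsto_of_closed_convex fun C hC hconv hclosed => ?_
  have hne : ∀ᶠ t : ℝ in 𝓝[≠] (0 : ℝ), t ≠ 0 := self_mem_nhdsWithin
  have hg' : ∀ᶠ q : ℝ × E × E in 𝓝 (0, x, w), q.1 ≠ 0 →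
      q.1⁻¹ • (g (q.2.1 + q.1 • q.2.2) - g q.2.1) ∈ C := by
    have h1 : ∀ᶠ q in 𝓝[≠] (0 : ℝ) ×ˢ (𝓝 x ×ˢ 𝓝 w),
      q.1⁻¹ • (g (q.2.1 + q.1 • q.2.2) - g q.2.1) ∈ C := hg hC
    rw [← nhdsWithin_univ (a := x), ← nhdsWithin_univ (a := w), ← nhdsWithin_prod_eq,
      ← nhdsWithin_prod_eq, eventually_nhdsWithin_iff] at h1
    exact h1.mono fun q hq hq0 => hq ⟨hq0, mem_univ _, mem_univ _⟩
  have key : ∀ᶠ t : ℝ in 𝓝 0, ∀ s ∈ Icc (0 : ℝ) 1,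
      HasDirDeriv f (x + (s * t) • u + t • w) u (g (x + (s * t) • u + t • w)) ∧
      HasDirDeriv f (x + (s * t) • u) u (g (x + (s * t) • u)) ∧
      (t ≠ 0 → t⁻¹ • (g (x + (s * t) • u + t • w) - g (x + (s * t) • u)) ∈ C) := by
    refine isCompact_Icc.eventually_forall_of_forall_eventually fun s _ => ?_
    have c1 : Continuous fun z : ℝ × ℝ => x + (z.2 * z.1) • u + z.1 • w := by fun_prop
    have c2 : Continuous fun z : ℝ × ℝ => x + (z.2 * z.1) • u := by fun_prop
    have c3 : Continuous fun z : ℝ × ℝ => (z.1, x + (z.2 * z.1) • u, w) := by fun_prop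
    have h1 := c1.tendsto (0, s)
    have h2 := c2.tendsto (0, s)
    have h3 := c3.tendsto (0, s)
    simp only [mul_zero, zero_smul, add_zero] at h1 h2 h3
    exact (h1.eventually hf).and ((h2.eventually hf).and (h3.eventually hg'))
  filter_upwards [nhdsWithin_le_nhds key, hne] with t hq ht
  -- the second difference is the increment over `[0, 1]` of the curve below, whose derivative is a
  -- first difference quotient of `g` in the direction `w`
  have hγ : ∀ s ∈ Icc (0 : ℝ) 1, HasDirDeriv
      (fun s : ℝ => (t⁻¹ * t⁻¹) • (f (x + t • w + (s * t) • u) + (-1 : ℝ) • f (x + (s * t) • u)))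
      s 1 (t⁻¹ • (g (x + (s * t) • u + t • w) - g (x + (s * t) • u))) := by
    intro s hs
    have a1 := (hq s hs).1
    rw [add_right_comm] at a1
    have := ((hasDirDeriv_line a1).add
      ((hasDirDeriv_line (hq s hs).2.1).const_smul (-1))).const_smul (t⁻¹ * t⁻¹)
    convert this using 1
    rw [smul_comm (-1 : ℝ) t, ← smul_add, smul_smul, mul_assoc, inv_mul_cancel₀ ht, mul_one,
      neg_one_smul, ← sub_eq_add_neg, add_right_comm]
  have := sub_mem_of_hasDirDeriv_mem hconv hclosed hγ fun s hs => (hq s hs).2.2 ht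
  convert this using 1
  rw [← smul_sub]
  simp only [one_mul, zero_mul, zero_smul, add_zero, neg_one_smul]
  rw [add_right_comm]
  congr 1; abel

/-- Symmetry of second directional derivatives. -/
theorem HasStrictDirDeriv.symm_second [TopologicalSpace E] [IsTopologicalAddGroup E]
    [ContinuousSMul ℝ E] [IsTopologicalAddGroup F] [ContinuousSMul ℝ F]
    [LocallyConvexSpace ℝ F] [T2Space F] {f g h : E → F} {x u w : E} {c d : F}
    (hf : ∀ᶠ y in 𝓝 x, HasDirDeriv f y u (g y)) (hg : HasStrictDirDeriv g x w c)
    (hf' : ∀ᶠ y in 𝓝 x, HasDirDeriv f y w (h y)) (hh : HasStrictDirDeriv h x u d) : c = d := by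
  refine tendsto_nhds_unique (tendsto_second_difference hf hg)
    ((tendsto_second_difference hf' hh).congr fun t => ?_)
  rw [add_right_comm x]; congr 1; abel

end DirectionalDerivatives

/-! ### Closure properties of Michal--Bastiani smooth maps -/

section CkOnLemmas

universe u u'

variable {F : Type*} [AddCommGroup F] [Module ℝ F] [TopologicalSpace F]

theorem CkOn.continuousOn {E : Type u} [AddCommGroup E] [Module ℝ E] [TopologicalSpace E] {k : ℕ}
    {f : E → F} {U : Set E} (h : CkOn k f U) : ContinuousOn f U := by
  cases k with
  | zero => exact h
  | succ k => exact h.1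

theorem CkOn.mono {k : ℕ} : ∀ {E : Type u} [AddCommGroup E] [Module ℝ E] [TopologicalSpace E]
    {f : E → F} {U V : Set E}, CkOn k f U → V ⊆ U → CkOn k f V := by
  induction k with
  | zero => intro E _ _ _ f U V h hV; exact ContinuousOn.mono h hV
  | succ k ih =>
    rintro E _ _ _ f U V ⟨h, df, h1, h2⟩ hV
    exact ⟨h.mono hV, df, fun x hx => h1 x (hV hx), ih h2 (prod_mono hV le_rfl)⟩

theorem CkOn.of_succ {k : ℕ} : ∀ {E : Type u} [AddCommGroup E] [Module ℝ E] [TopologicalSpace E]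
    {f : E → F} {U : Set E}, CkOn (k + 1) f U → CkOn k f U := by
  induction k with
  | zero => intro E _ _ _ f U h; exact h.continuousOn
  | succ k ih =>
    rintro E _ _ _ f U ⟨h, df, h1, h2⟩
    exact ⟨h, df, h1, ih h2⟩

theorem CkOn.congr {k : ℕ} {E : Type u} [AddCommGroup E] [Module ℝ E] [TopologicalSpace E]
    [ContinuousAdd E] [ContinuousSMul ℝ E] {f g : E → F} {U : Set E} (hU : IsOpen U)
    (h : CkOn k f U) (hfg : EqOn g f U) : CkOn k g U := by
  cases k with
  | zero => exact ContinuousOn.congr h hfg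
  | succ k =>
    obtain ⟨h, df, h1, h2⟩ := h
    exact ⟨h.congr hfg, df, fun x hx v => (h1 x hx v).congr_of_eventuallyEq
      (hfg.eventuallyEq_of_mem (hU.mem_nhds hx)), h2⟩

theorem CkOn.comp_affine {k : ℕ} : ∀ {E : Type u} [AddCommGroup E] [Module ℝ E]
    [TopologicalSpace E] [ContinuousAdd E] {E' : Type u'} [AddCommGroup E'] [Module ℝ E']
    [TopologicalSpace E'] {f : E → F} {U : Set E}, CkOn k f U → ∀ (L : E' →L[ℝ] E) (c : E),
    CkOn k (fun x => f (L x + c)) {x | L x + c ∈ U} := by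
  induction k with
  | zero =>
    intro E _ _ _ _ E' _ _ _ f U h L c
    exact ContinuousOn.comp h (by fun_prop) fun _ hx => hx
  | succ k ih =>
    rintro E _ _ _ _ E' _ _ _ f U ⟨h, df, h1, h2⟩ L c
    refine ⟨h.comp (by fun_prop) fun _ hx => hx,
      fun q => df (L.prodMap L q + (c, 0)), fun x hx v => ?_, ?_⟩
    · have h3 := h1 (L x + c) hx (L v)
      have h4 : L.prodMap L (x, v) + (c, 0) = (L x + c, L v) := Prod.ext rfl (add_zero _)
      simp only [HasDirDeriv, h4, map_add, map_smul, add_right_comm] at h3 ⊢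
      exact h3
    · exact (ih h2 (L.prodMap L) (c, 0)).mono fun q hq => ⟨hq.1, mem_univ _⟩

theorem CkOn.comp_clm {k : ℕ} {E : Type u} [AddCommGroup E] [Module ℝ E]
    [TopologicalSpace E] [ContinuousAdd E] {E' : Type u'} [AddCommGroup E'] [Module ℝ E']
    [TopologicalSpace E'] {f : E → F} {U : Set E} (h : CkOn k f U) (L : E' →L[ℝ] E) :
    CkOn k (fun x => f (L x)) (L ⁻¹' U) := by
  have := h.comp_affine L 0
  simp only [add_zero] at this
  exact this

theorem CkOn.fst_lift {k : ℕ} {E : Type u} [AddCommGroup E] [Module ℝ E] [TopologicalSpace E]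
    [ContinuousAdd E] {f : E → F} {U : Set E} (h : CkOn k f U) :
    CkOn k (fun q : E × E => f q.1) (U ×ˢ univ) :=
  (h.comp_clm (ContinuousLinearMap.fst ℝ E E)).mono fun _ hq => hq.1

theorem CkOn.sum_smul [IsTopologicalAddGroup F] [ContinuousSMul ℝ F] {ι : Type*} (s : Finset ι)
    (c : ι → ℝ) {k : ℕ} : ∀ {E : Type u} [AddCommGroup E] [Module ℝ E] [TopologicalSpace E]
    {f : ι → E → F} {U : Set E}, (∀ i, CkOn k (f i) U) →
    CkOn k (fun x => ∑ i ∈ s, c i • f i x) U := by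
  induction k with
  | zero => intro E _ _ _ f U h
            exact continuousOn_finsetSum _ fun i _ => ContinuousOn.const_smul (h i) (c i)
  | succ k ih =>
    intro E _ _ _ f U h
    choose hf df h1 h2 using h
    refine ⟨continuousOn_finsetSum _ fun i _ => (hf i).const_smul (c i),
      fun q => ∑ i ∈ s, c i • df i q, fun x hx v => ?_, ih h2⟩
    exact HasDirDeriv.sum s fun i _ => (h1 i x hx v).const_smul (c i)

/-- By the Leibniz rule, the derivative of `Q(f₁, …, f_l)` is a sum of functions of the same kind,
which makes the induction on the order of differentiability work. -/
theorem CkOn.multilinear [IsTopologicalAddGroup F] [ContinuousSMul ℝ F] {G : Type*}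
    [AddCommGroup G] [Module ℝ G] [TopologicalSpace G] [IsTopologicalAddGroup G]
    [ContinuousSMul ℝ G] {ι : Type*} [Fintype ι]
    (Q : ContinuousMultilinearMap ℝ (fun _ : ι => F) G) {k : ℕ} :
    ∀ {E : Type u} [AddCommGroup E] [Module ℝ E] [TopologicalSpace E] [ContinuousAdd E]
    {f : ι → E → F} {U : Set E}, (∀ i, CkOn k (f i) U) →
    CkOn k (fun x => Q (fun i => f i x)) U := by
  classical
  induction k with
  | zero => intro E _ _ _ _ f U h
            exact Q.cont.comp_continuousOn (continuousOn_pi.2 h)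
  | succ k ih =>
    intro E _ _ _ _ f U h
    have h' := fun i => (h i).of_succ
    choose hf df h1 h2 using h
    refine ⟨Q.cont.comp_continuousOn (continuousOn_pi.2 hf),
      fun q => ∑ i, (1 : ℝ) • Q (fun j => Function.update (fun j q => f j q.1) i (df i) j q),
      fun x hx v => ?_, ?_⟩
    · have := HasDirDeriv.multilinear Q fun i => h1 i x hx v
      convert this using 2 with i
      rw [one_smul]
      congr 1
      ext j
      by_cases hj : j = i
      · subst hj; simp
      · simp [hj]
    · refine CkOn.sum_smul Finset.univ _ fun i => ih fun j => ?_
      by_cases hj : j = i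
      · subst hj; simpa using h2 j
      · simpa [hj] using (h' j).fst_lift

/-- The product of an algebra as a continuous bilinear map. -/
noncomputable def continuousMulMultilinear (A : Type*) [Ring A] [Algebra ℝ A] [TopologicalSpace A]
    [IsTopologicalRing A] : ContinuousMultilinearMap ℝ (fun _ : Fin 2 => A) A where
  toMultilinearMap := MultilinearMap.mkPiAlgebraFin ℝ 2 A
  cont := by
    have : Continuous fun x : Fin 2 → A => x 0 * x 1 := by fun_prop
    refine this.congr fun x => ?_
    simp

@[simp]
theorem continuousMulMultilinear_apply {A : Type*} [Ring A] [Algebra ℝ A] [TopologicalSpace A]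
    [IsTopologicalRing A] (x : Fin 2 → A) : continuousMulMultilinear A x = x 0 * x 1 := by
  change MultilinearMap.mkPiAlgebraFin ℝ 2 A x = _
  simp

theorem CkOn.mul {A : Type*} [Ring A] [Algebra ℝ A] [TopologicalSpace A]
    [IsTopologicalRing A] [ContinuousSMul ℝ A] {k : ℕ} {E : Type u} [AddCommGroup E] [Module ℝ E]
    [TopologicalSpace E] [ContinuousAdd E] {f g : E → A} {U : Set E} (hf : CkOn k f U)
    (hg : CkOn k g U) :
    CkOn k (fun x => f x * g x) U := by
  have := CkOn.multilinear (continuousMulMultilinear A) (f := ![f, g]) (U := U) (k := k)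
    (by intro i; fin_cases i <;> simpa)
  simpa using this

theorem CkOn.lincomb [IsTopologicalAddGroup F] [ContinuousSMul ℝ F] {k : ℕ} {E : Type u}
    [AddCommGroup E] [Module ℝ E] [TopologicalSpace E] {f g : E → F} {U : Set E} (a b : ℝ)
    (hf : CkOn k f U) (hg : CkOn k g U) : CkOn k (fun x => a • f x + b • g x) U := by
  have := CkOn.sum_smul Finset.univ ![a, b] (f := ![f, g]) (U := U) (k := k)
    (by intro i; fin_cases i <;> simpa)
  simpa using this

theorem CkOn.hasStrictDirDeriv [IsTopologicalAddGroup F] [ContinuousSMul ℝ F]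
    [LocallyConvexSpace ℝ F] [T2Space F] {E : Type u} [AddCommGroup E] [Module ℝ E]
    [TopologicalSpace E] [IsTopologicalAddGroup E] [ContinuousSMul ℝ E] {f : E → F} {U : Set E}
    (hU : IsOpen U) (h : CkOn 1 f U) {x : E} (hx : x ∈ U) (v : E) :
    HasStrictDirDeriv f x v (dirDeriv f x v) := by
  obtain ⟨-, df, h1, h2⟩ := h
  rw [(h1 x hx v).dirDeriv_eq]
  refine hasStrictDirDeriv_of_continuousAt ?_
    (ContinuousOn.continuousAt h2 ((hU.prod isOpen_univ).mem_nhds ⟨hx, mem_univ _⟩))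
  filter_upwards [hU.mem_nhds hx] with y hy u using h1 y hy u

theorem CkOn.ckOn_dirDeriv [T2Space F] {k : ℕ} {E : Type u} [AddCommGroup E] [Module ℝ E]
    [TopologicalSpace E] [IsTopologicalAddGroup E] [ContinuousSMul ℝ E] {f : E → F} {U : Set E}
    (hU : IsOpen U) (h : CkOn (k + 1) f U) :
    CkOn k (fun q : E × E => dirDeriv f q.1 q.2) (U ×ˢ univ) := by
  obtain ⟨-, df, h1, h2⟩ := h
  exact h2.congr (hU.prod isOpen_univ) fun q hq => (h1 q.1 hq.1 q.2).dirDeriv_eq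

theorem CkOn.dirDeriv_const_dir [T2Space F] {k : ℕ} {E : Type u}
    [AddCommGroup E] [Module ℝ E] [TopologicalSpace E] [IsTopologicalAddGroup E]
    [ContinuousSMul ℝ E] {f : E → F} {U : Set E} (hU : IsOpen U) (h : CkOn (k + 1) f U) (u : E) :
    CkOn k (fun y => dirDeriv f y u) U := by
  have := (h.ckOn_dirDeriv hU).comp_affine (ContinuousLinearMap.inl ℝ E E) (0, u)
  simp only [ContinuousLinearMap.inl_apply, Prod.mk_add_mk, add_zero, zero_add] at this
  exact this.mono fun y hy => ⟨hy, mem_univ _⟩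

section Linearity

variable [IsTopologicalAddGroup F] [ContinuousSMul ℝ F]
    [LocallyConvexSpace ℝ F] [T2Space F] {E : Type u} [AddCommGroup E] [Module ℝ E]
    [TopologicalSpace E] [IsTopologicalAddGroup E] [ContinuousSMul ℝ E] {f : E → F} {U : Set E}

theorem CkOn.dirDeriv_add (hU : IsOpen U) (h : CkOn 1 f U) {x : E} (hx : x ∈ U) (v w : E) :
    dirDeriv f x (v + w) = dirDeriv f x v + dirDeriv f x w :=
  ((h.hasStrictDirDeriv hU hx v).add_dir (h.hasStrictDirDeriv hU hx w).hasDirDeriv).dirDeriv_eq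

theorem CkOn.dirDeriv_smul (hU : IsOpen U) (h : CkOn 1 f U) {x : E} (hx : x ∈ U) (c : ℝ) (v : E) :
    dirDeriv f x (c • v) = c • dirDeriv f x v :=
  ((h.hasStrictDirDeriv hU hx v).hasDirDeriv.smul_dir c).dirDeriv_eq

/-- Schwarz's theorem for Michal--Bastiani `C^2` maps. -/
theorem CkOn.dirDeriv_comm (hU : IsOpen U) (h : CkOn 2 f U) {x : E} (hx : x ∈ U) (u w : E) :
    dirDeriv (fun y => dirDeriv f y u) x w = dirDeriv (fun y => dirDeriv f y w) x u := by
  have h1 : ∀ a : E, ∀ᶠ y in 𝓝 x, HasDirDeriv f y a (dirDeriv f y a) := by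
    intro a
    filter_upwards [hU.mem_nhds hx] with y hy
    exact (h.of_succ.hasStrictDirDeriv hU hy a).hasDirDeriv
  exact HasStrictDirDeriv.symm_second (h1 u)
    ((h.dirDeriv_const_dir hU u).hasStrictDirDeriv hU hx w) (h1 w)
    ((h.dirDeriv_const_dir hU w).hasStrictDirDeriv hU hx u)

end Linearity

end CkOnLemmas

/-! ### Alternating sums over permutations -/

section AlternatingSums

variable {E W : Type*} [AddCommGroup W] [Module ℝ W] {N : ℕ}

/-- The antisymmetrization `∑_σ sign(σ) F(v ∘ σ)`, without normalizing factor. -/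
def altSum (F : (Fin N → E) → W) (v : Fin N → E) : W :=
  ∑ σ : Equiv.Perm (Fin N), ((Equiv.Perm.sign σ : ℤ) : ℝ) • F (v ∘ σ)

theorem altSum_add (F G : (Fin N → E) → W) (v : Fin N → E) :
    altSum (fun u => F u + G u) v = altSum F v + altSum G v := by
  simp [altSum, smul_add, Finset.sum_add_distrib]

theorem altSum_smul (c : ℝ) (F : (Fin N → E) → W) (v : Fin N → E) :
    altSum (fun u => c • F u) v = c • altSum F v := by
  simp only [altSum, Finset.smul_sum]
  exact Finset.sum_congr rfl fun σ _ => smul_comm _ _ _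

theorem altSum_sum {ι : Type*} (s : Finset ι) (F : ι → (Fin N → E) → W) (v : Fin N → E) :
    altSum (fun u => ∑ i ∈ s, F i u) v = ∑ i ∈ s, altSum (F i) v := by
  simp only [altSum, Finset.smul_sum]
  exact Finset.sum_comm

theorem altSum_comp_perm (F : (Fin N → E) → W) (ρ : Equiv.Perm (Fin N)) (v : Fin N → E) :
    altSum (fun u => F (u ∘ ρ)) v = ((Equiv.Perm.sign ρ : ℤ) : ℝ) • altSum F v := by
  simp only [altSum, Finset.smul_sum]
  refine Fintype.sum_equiv (Equiv.mulRight ρ) _ _ fun σ => ?_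
  simp only [Equiv.coe_mulRight, Equiv.Perm.sign_mul, smul_smul]
  congr 1
  rcases Int.units_eq_one_or (Equiv.Perm.sign ρ) with h | h <;> simp [h]

theorem altSum_comp_swap (F : (Fin N → E) → W) {i j : Fin N} (h : i ≠ j) (v : Fin N → E) :
    altSum (fun u => F (u ∘ Equiv.swap i j)) v = -altSum F v := by
  rw [altSum_comp_perm, Equiv.Perm.sign_swap h]; simp

/-- Expansion of an antisymmetrization along the first argument. A permutation of `n + 1` letters
is the choice of the image `i` of `0` and of a permutation of the remaining letters. -/
theorem sum_altSum_cons {n : ℕ} (G : (Fin (n + 1) → E) → W) (v : Fin (n + 1) → E) :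
    ∑ i : Fin (n + 1), (-1 : ℝ) ^ (i : ℕ) •
      altSum (fun w => G (Fin.cons (v i) w)) (i.removeNth v) = altSum G v := by
  simp only [altSum, Finset.smul_sum]
  rw [← Fintype.sum_prod_type']
  -- `e (i, σ)` maps `0` to `i` and `j + 1` to the element of `{0, …, n} \ {i}` numbered `σ j`
  let e : Fin (n + 1) × Equiv.Perm (Fin n) → Equiv.Perm (Fin (n + 1)) :=
    fun q => q.1.cycleRange.symm * Equiv.Perm.decomposeFin.symm (0, q.2)
  have e0 : ∀ q, e q 0 = q.1 := by
    intro q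
    simp [e, Equiv.Perm.mul_apply, Fin.cycleRange_symm_zero]
  have es : ∀ q (j : Fin n), e q j.succ = q.1.succAbove (q.2 j) := by
    intro q j
    simp [e, Equiv.Perm.mul_apply, Fin.cycleRange_symm_succ]
  have hinj : Function.Injective e := by
    intro q q' h
    have h1 : q.1 = q'.1 := by rw [← e0 q, ← e0 q', h]
    refine Prod.ext h1 (Equiv.ext fun j => ?_)
    have h2 := congrArg (fun f => f j.succ) h
    simp only [es, h1] at h2
    exact Fin.succAbove_right_injective h2
  have hbij : Function.Bijective e := by
    rw [Fintype.bijective_iff_injective_and_card]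
    refine ⟨hinj, ?_⟩
    simp [Fintype.card_perm, Nat.factorial_succ]
  refine Fintype.sum_bijective e hbij _ _ fun q => ?_
  have hs : ((Equiv.Perm.sign (e q) : ℤ) : ℝ)
      = (-1 : ℝ) ^ (q.1 : ℕ) * ((Equiv.Perm.sign q.2 : ℤ) : ℝ) := by
    simp only [e, Equiv.Perm.sign_mul, Equiv.Perm.sign_symm, Fin.sign_cycleRange,
      Equiv.Perm.decomposeFin.symm_sign]
    simp
  rw [hs, smul_smul]
  congr 2
  funext k
  refine Fin.cases ?_ (fun j => ?_) k
  · simp [e0]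
  · simp [es, Fin.removeNth]

end AlternatingSums

/-! ### Invariant polynomials and the algebra of the transgression formula -/

section BianchiIdentity

variable {A : Type*} [Ring A] [Algebra ℝ A] {E : Type*} (T : E → A) (S : E → E → A)
  (R : E → E → E → A)

/-- The signed sum of `X` over all orderings of its three arguments. -/
def antisymm3 (X : E → E → E → A) (x a b : E) : A :=
  X x a b - X a x b - X x b a + X a b x + X b x a - X b a x

/-- The curvature `t dθ + ½ t² [θ, θ]` of the one-form `tθ` at a point, where `T = θ` and
`S(u, w) = D_u θ(w)` in a chart. -/
def scaledCurvature (t : ℝ) (a b : E) : A :=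
  t • (S a b - S b a) + t ^ 2 • ⁅T a, T b⁆

/-- The derivative of `scaledCurvature` with respect to the parameter `t`. -/
def scaledCurvatureDeriv (t : ℝ) (a b : E) : A :=
  (S a b - S b a) + (2 * t) • ⁅T a, T b⁆

/-- The derivative of `scaledCurvature` in the direction `x`, where
`R(x, a, b) = D_x D_a θ(b)`. -/
def scaledCurvatureDirDeriv (t : ℝ) (x a b : E) : A :=
  t • (R x a b - R x b a) + t ^ 2 • (⁅S x a, T b⁆ + ⁅T a, S x b⁆)

/-- The Bianchi identity `dφ_t = -t [θ, φ_t]`, in antisymmetrized form. The terms of third order in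
`θ` cancel by the Jacobi identity, and those in `R` by symmetry of second derivatives. -/
theorem antisymm3_bianchi (hR : ∀ x a b, R x a b = R a x b) (t : ℝ) :
    antisymm3 (scaledCurvatureDirDeriv T S R t)
      = antisymm3 (fun x a b => (-t) • ⁅T x, scaledCurvature T S t a b⁆) := by
  funext x a b
  simp only [antisymm3, scaledCurvatureDirDeriv, scaledCurvature, Ring.lie_def, mul_add, add_mul,
    mul_sub, sub_mul, smul_mul_assoc, mul_smul_comm, mul_assoc]
  rw [hR a x b, hR b x a, hR b a x]
  module

end BianchiIdentity

section TransgressionAlgebra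

variable {A : Type*} [Ring A] [Algebra ℝ A] [TopologicalSpace A] {𝕂 : Type*} [RCLike 𝕂] {m : ℕ}

/-- The infinitesimal form of invariance, obtained by differentiating
`Q((1 + sX) Y₁, …, (1 + sX) Y_l) = Q(Y₁ (1 + sX), …, Y_l (1 + sX))` at `s = 0`. In this form no
derivative of the inversion is needed. -/
theorem IsInvariantPolynomial.sum_bracket_eq_zero [ContinuousInverseAlgebra A] {l : ℕ}
    {Q : ContinuousMultilinearMap ℝ (fun _ : Fin l => A) 𝕂} (hQ : IsInvariantPolynomial Q)
    (X : A) (Y : Fin l → A) : ∑ i, Q (Function.update Y i ⁅X, Y i⁆) = 0 := by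
  have hline : ∀ (Z : Fin l → A), HasDirDeriv (fun s : ℝ => Q (fun i => Y i + s • Z i)) 0 1
      (∑ i, Q (Function.update Y i (Z i))) := by
    intro Z
    have h1 : ∀ i, HasDirDeriv (fun s : ℝ => Y i + s • Z i) 0 1 (Z i) := by
      intro i
      have := (hasDirDeriv_const (Y i) (0 : ℝ) 1).add
        ((hasDirDeriv_id (0 : ℝ) 1).clm_comp (ContinuousLinearMap.toSpanSingleton ℝ (Z i)))
      simpa using this
    simpa using HasDirDeriv.multilinear Q h1
  have hu : ∀ᶠ s : ℝ in 𝓝 0, IsUnit (1 + s • X) := by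
    refine (tendsto_line (1 : A) X).eventually ?_
    exact ContinuousInverseAlgebra.isOpen_units.mem_nhds isUnit_one
  have heq : (fun s : ℝ => Q (fun i => Y i + s • (X * Y i)))
      =ᶠ[𝓝 0] fun s : ℝ => Q (fun i => Y i + s • (Y i * X)) := by
    filter_upwards [hu] with s hs
    obtain ⟨g, hg⟩ := hs
    have := hQ.invariant g (fun i => Y i * g)
    have h1 : ∀ i, Y i + s • (X * Y i) = g * (Y i * g) * ((g⁻¹ : Aˣ) : A) := by
      intro i
      rw [mul_assoc, mul_assoc, Units.mul_inv, mul_one, hg, add_mul, one_mul, smul_mul_assoc]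
    have h2 : ∀ i, Y i + s • (Y i * X) = Y i * g := by
      intro i
      rw [hg, mul_add, mul_one, mul_smul_comm]
    simpa only [h1, h2] using this
  have h3 := ((hline fun i => Y i * X).congr_of_eventuallyEq heq).unique (hline fun i => X * Y i)
  simp only [Ring.lie_def, ContinuousMultilinearMap.map_update_sub, Finset.sum_sub_distrib]
  rw [h3, sub_self]

variable {E : Type*} (Q : ContinuousMultilinearMap ℝ (fun _ : Fin (m + 1) => A) 𝕂)
  (T : E → A) (S : E → E → A) (R : E → E → E → A)

/-- `X ↦ Alt Q(T(u₁), φ(u₂, u₃), …, X(u₀, u_{2j+2}, u_{2j+3}), …, φ(u_{2m}, u_{2m+1}))`, where the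
three-argument function `X` takes the place of the `j`-th factor `φ`. -/
noncomputable def cubicAlt (φ : E → E → A) (j : Fin m)
    (v : Fin (2 * m + 1 + 1) → E) :
    (E → E → E → A) →ₗ[ℝ] 𝕂 where
  toFun X := altSum (fun u : Fin (2 * m + 1 + 1) → E => Q (Fin.cons (T (u 1)) (Function.update
    (fun i : Fin m => φ (u ⟨2 * i + 2, by omega⟩) (u ⟨2 * i + 3, by omega⟩)) j
    (X (u 0) (u ⟨2 * j + 2, by omega⟩) (u ⟨2 * j + 3, by omega⟩))))) v
  map_add' X Y := by
    rw [← altSum_add]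
    simp only [Fin.cons_update, Pi.add_apply, ContinuousMultilinearMap.map_update_add]
  map_smul' c X := by
    simp only [RingHom.id_apply]
    rw [← altSum_smul]
    simp only [Fin.cons_update, Pi.smul_apply, ContinuousMultilinearMap.map_update_smul]

theorem cubicAlt_apply (φ : E → E → A) (j : Fin m) (v : Fin (2 * m + 1 + 1) → E)
    (X : E → E → E → A) :
    cubicAlt Q T φ j v X =
      altSum (fun u : Fin (2 * m + 1 + 1) → E => Q (Fin.cons (T (u 1)) (Function.update
        (fun i : Fin m => φ (u ⟨2 * i + 2, by omega⟩) (u ⟨2 * i + 3, by omega⟩)) j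
        (X (u 0) (u ⟨2 * j + 2, by omega⟩) (u ⟨2 * j + 3, by omega⟩))))) v :=
  rfl

theorem cubicAlt_swap_left (φ : E → E → A) (j : Fin m) (v : Fin (2 * m + 1 + 1) → E)
    (X : E → E → E → A) :
    cubicAlt Q T φ j v (fun x a b => X a x b) = -cubicAlt Q T φ j v X := by
  have hne : (0 : Fin (2 * m + 1 + 1)) ≠ ⟨2 * j + 2, by omega⟩ := by
    simp [Fin.ext_iff]
  rw [cubicAlt_apply, cubicAlt_apply, ← altSum_comp_swap _ hne v]
  congr 1
  funext u
  have h1 : Equiv.swap (0 : Fin (2 * m + 1 + 1)) ⟨2 * j + 2, by omega⟩ 1 = 1 :=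
    Equiv.swap_apply_of_ne_of_ne (by simp) (by simp [Fin.ext_iff])
  have h2 : Equiv.swap (0 : Fin (2 * m + 1 + 1)) ⟨2 * j + 2, by omega⟩ ⟨2 * j + 3, by omega⟩
      = ⟨2 * j + 3, by omega⟩ :=
    Equiv.swap_apply_of_ne_of_ne (by simp [Fin.ext_iff]) (by simp [Fin.ext_iff])
  simp only [Function.comp_apply, h1, h2, Equiv.swap_apply_left, Equiv.swap_apply_right]
  congr 2
  funext i
  by_cases hi : i = j
  · subst hi; simp
  · have hi' : (i : ℕ) ≠ j := fun h => hi (Fin.ext h)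
    rw [Function.update_of_ne hi, Function.update_of_ne hi,
      Equiv.swap_apply_of_ne_of_ne, Equiv.swap_apply_of_ne_of_ne] <;>
    simp [Fin.ext_iff] <;> omega

theorem cubicAlt_swap_right (φ : E → E → A) (j : Fin m) (v : Fin (2 * m + 1 + 1) → E)
    (X : E → E → E → A) :
    cubicAlt Q T φ j v (fun x a b => X x b a) = -cubicAlt Q T φ j v X := by
  have hne : (⟨2 * j + 2, by omega⟩ : Fin (2 * m + 1 + 1)) ≠ ⟨2 * j + 3, by omega⟩ := by
    simp
  rw [cubicAlt_apply, cubicAlt_apply, ← altSum_comp_swap _ hne v]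
  congr 1
  funext u
  have h1 : Equiv.swap (⟨2 * j + 2, by omega⟩ : Fin (2 * m + 1 + 1)) ⟨2 * j + 3, by omega⟩ 1 = 1 :=
    Equiv.swap_apply_of_ne_of_ne (by simp [Fin.ext_iff]) (by simp [Fin.ext_iff])
  have h2 : Equiv.swap (⟨2 * j + 2, by omega⟩ : Fin (2 * m + 1 + 1)) ⟨2 * j + 3, by omega⟩ 0 = 0 :=
    Equiv.swap_apply_of_ne_of_ne (by simp [Fin.ext_iff]) (by simp [Fin.ext_iff])
  simp only [Function.comp_apply, h1, h2, Equiv.swap_apply_left, Equiv.swap_apply_right]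
  congr 2
  funext i
  by_cases hi : i = j
  · subst hi; simp
  · have hi' : (i : ℕ) ≠ j := fun h => hi (Fin.ext h)
    rw [Function.update_of_ne hi, Function.update_of_ne hi,
      Equiv.swap_apply_of_ne_of_ne, Equiv.swap_apply_of_ne_of_ne] <;>
    simp [Fin.ext_iff] <;> omega

theorem cubicAlt_antisymm3 (φ : E → E → A) (j : Fin m) (v : Fin (2 * m + 1 + 1) → E)
    (X : E → E → E → A) :
    cubicAlt Q T φ j v (antisymm3 X) = (6 : ℝ) • cubicAlt Q T φ j v X := by
  have h1 := cubicAlt_swap_left Q T φ j v X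
  have h2 := cubicAlt_swap_right Q T φ j v X
  have h3 := cubicAlt_swap_right Q T φ j v (fun x a b => X a x b)
  have h4 := cubicAlt_swap_left Q T φ j v (fun x a b => X x b a)
  have h5 := cubicAlt_swap_right Q T φ j v (fun x a b => X a b x)
  have h : antisymm3 X = X - (fun x a b => X a x b) - (fun x a b => X x b a)
      + (fun x a b => X a b x) + (fun x a b => X b x a) - (fun x a b => X b a x) := rfl
  rw [h, map_sub, map_add, map_add, map_sub, map_sub, h5, h4, h3, h2, h1]
  module

/-- The value of `cubicAlt` only depends on the antisymmetrization of the three-argument function,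
so identities modulo antisymmetrization may be used inside `Q`. -/
theorem cubicAlt_congr (φ : E → E → A) (j : Fin m) (v : Fin (2 * m + 1 + 1) → E)
    {X Y : E → E → E → A} (h : antisymm3 X = antisymm3 Y) :
    cubicAlt Q T φ j v X = cubicAlt Q T φ j v Y := by
  have := congrArg (cubicAlt Q T φ j v) h
  rw [cubicAlt_antisymm3, cubicAlt_antisymm3] at this
  exact smul_right_injective 𝕂 (by norm_num : (6 : ℝ) ≠ 0) this

/-- The factors of `Q` occupy blocks of two consecutive arguments, and interchanging two blocks is
an even permutation. Hence, by symmetry of `Q`, a distinguished factor may be moved to the front. -/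
theorem altSum_update_pair (hQ : IsInvariantPolynomial Q) (φ ψ : E → E → A) (i : Fin (m + 1))
    (v : Fin (2 * m + 1 + 1) → E) :
    altSum (fun u : Fin (2 * m + 1 + 1) → E => Q (Function.update
      (fun k : Fin (m + 1) => φ (u ⟨2 * k, by omega⟩) (u ⟨2 * k + 1, by omega⟩)) i
      (ψ (u ⟨2 * i, by omega⟩) (u ⟨2 * i + 1, by omega⟩)))) v
    = altSum (fun u : Fin (2 * m + 1 + 1) → E => Q (Fin.cons (ψ (u 0) (u 1)) (fun k : Fin m =>
        φ (u ⟨2 * k + 2, by omega⟩) (u ⟨2 * k + 3, by omega⟩)))) v := by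
  -- the interchange of the blocks `{0, 1}` and `{2i, 2i + 1}`
  let ρ : Equiv.Perm (Fin (2 * m + 1 + 1)) :=
    Equiv.swap 0 ⟨2 * i, by omega⟩ * Equiv.swap 1 ⟨2 * i + 1, by omega⟩
  have hsign : Equiv.Perm.sign ρ = 1 := by
    rw [Equiv.Perm.sign_mul, Equiv.Perm.sign_swap', Equiv.Perm.sign_swap']
    by_cases hi : (i : ℕ) = 0 <;> simp [Fin.ext_iff, hi, Ne.symm]
  have hval : ∀ k : Fin (m + 1), ρ ⟨2 * k, by omega⟩ = ⟨2 * (Equiv.swap 0 i k), by omega⟩ ∧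
      ρ ⟨2 * k + 1, by omega⟩ = ⟨2 * (Equiv.swap 0 i k) + 1, by omega⟩ := by
    intro k
    have hρ : ∀ x, ρ x = Equiv.swap 0 ⟨2 * i, by omega⟩ (Equiv.swap 1 ⟨2 * i + 1, by omega⟩ x) :=
      fun _ => rfl
    have hi := i.2
    rw [hρ, hρ]
    simp only [Equiv.swap_apply_def, Fin.ext_iff, apply_ite Fin.val, Fin.val_zero, Fin.val_one]
    constructor
    · split_ifs <;> omega
    · have h1 : (if 2 * (k : ℕ) + 1 = 1 then 2 * (i : ℕ) + 1
          else if 2 * (k : ℕ) + 1 = 2 * i + 1 then 1 else 2 * k + 1)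
          = 2 * (if (k : ℕ) = 0 then (i : ℕ) else if (k : ℕ) = i then 0 else k) + 1 := by
        by_cases hk : (k : ℕ) = 0 <;> by_cases hki : (k : ℕ) = i <;> simp [hk, hki]
        split_ifs <;> rfl
      rw [h1, if_neg (by omega), if_neg (by omega)]
  have h := altSum_comp_perm (fun u : Fin (2 * m + 1 + 1) → E => Q (Fin.cons (ψ (u 0) (u 1))
    (fun k : Fin m => φ (u ⟨2 * k + 2, by omega⟩) (u ⟨2 * k + 3, by omega⟩)))) ρ v
  rw [hsign] at h
  simp only [Units.val_one, Int.cast_one, one_smul] at h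
  rw [← h]
  congr 1
  funext u
  rw [← hQ.symmetric (Equiv.swap 0 i)]
  congr 1
  funext k
  refine Fin.cases ?_ (fun k => ?_) k
  · have := hval 0
    simp only [Equiv.swap_apply_left] at this
    simp only [Function.comp_apply, Equiv.swap_apply_left, Function.update_self, Fin.cons_zero]
    exact (congrArg₂ (fun x y => ψ (u x) (u y)) this.1 this.2).symm
  · have := hval k.succ
    have hne : Equiv.swap 0 i k.succ ≠ i := by
      rw [Ne, Equiv.swap_apply_eq_iff, Equiv.swap_apply_right]
      exact Fin.succ_ne_zero k
    simp only [Function.comp_apply, Function.update_of_ne hne, Fin.cons_succ]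
    exact (congrArg₂ (fun x y => φ (u x) (u y)) this.1 this.2).symm

variable [ContinuousInverseAlgebra A]

/-- The algebraic core of the transgression formula:
`d Q(θ ∧ φ_t^m) = Q(φ_t' ∧ φ_t^m)` for the curvature `φ_t` of `tθ`. -/
theorem altSum_deriv_transgression (hQ : IsInvariantPolynomial Q)
    (hR : ∀ x a b, R x a b = R a x b) (t : ℝ) (v : Fin (2 * m + 1 + 1) → E) :
    altSum (fun u : Fin (2 * m + 1 + 1) → E =>
      Q (Fin.cons (S (u 0) (u 1)) (fun i : Fin m =>
        scaledCurvature T S t (u ⟨2 * i + 2, by omega⟩) (u ⟨2 * i + 3, by omega⟩))) +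
      ∑ j : Fin m, Q (Fin.cons (T (u 1)) (Function.update (fun i : Fin m =>
        scaledCurvature T S t (u ⟨2 * i + 2, by omega⟩) (u ⟨2 * i + 3, by omega⟩)) j
        (scaledCurvatureDirDeriv T S R t (u 0) (u ⟨2 * j + 2, by omega⟩)
          (u ⟨2 * j + 3, by omega⟩))))) v
    = (1 / 2 : ℝ) • altSum (fun u : Fin (2 * m + 1 + 1) → E =>
      Q (Fin.cons (scaledCurvatureDeriv T S t (u 0) (u 1)) (fun i : Fin m =>
        scaledCurvature T S t (u ⟨2 * i + 2, by omega⟩) (u ⟨2 * i + 3, by omega⟩)))) v := by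
  rw [altSum_add, altSum_sum]
  -- the Bianchi identity in the `j`-th factor
  have h1 : ∀ j : Fin m, altSum (fun u : Fin (2 * m + 1 + 1) → E =>
      Q (Fin.cons (T (u 1)) (Function.update (fun i : Fin m =>
        scaledCurvature T S t (u ⟨2 * i + 2, by omega⟩) (u ⟨2 * i + 3, by omega⟩)) j
        (scaledCurvatureDirDeriv T S R t (u 0) (u ⟨2 * j + 2, by omega⟩)
          (u ⟨2 * j + 3, by omega⟩))))) v
      = altSum (fun u : Fin (2 * m + 1 + 1) → E =>
      Q (Fin.cons (T (u 1)) (Function.update (fun i : Fin m =>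
        scaledCurvature T S t (u ⟨2 * i + 2, by omega⟩) (u ⟨2 * i + 3, by omega⟩)) j
        ((-t) • ⁅T (u 0), scaledCurvature T S t (u ⟨2 * j + 2, by omega⟩)
          (u ⟨2 * j + 3, by omega⟩)⁆)))) v := fun j =>
    cubicAlt_congr Q T (scaledCurvature T S t) j v (antisymm3_bianchi T S R hR t)
  rw [Finset.sum_congr rfl fun j _ => h1 j, ← altSum_sum]
  -- invariance moves the bracket with `T (u 0)` from the factors `φ_t` to the factor `T (u 1)`
  have h2 : ∀ u : Fin (2 * m + 1 + 1) → E, ∑ j : Fin m, Q (Fin.cons (T (u 1)) (Function.update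
      (fun i : Fin m =>
        scaledCurvature T S t (u ⟨2 * i + 2, by omega⟩) (u ⟨2 * i + 3, by omega⟩)) j
        ((-t) • ⁅T (u 0), scaledCurvature T S t (u ⟨2 * j + 2, by omega⟩)
          (u ⟨2 * j + 3, by omega⟩)⁆)))
      = t • Q (Fin.cons ⁅T (u 0), T (u 1)⁆ (fun i : Fin m =>
        scaledCurvature T S t (u ⟨2 * i + 2, by omega⟩) (u ⟨2 * i + 3, by omega⟩))) := by
    intro u
    have := hQ.sum_bracket_eq_zero (T (u 0)) (Fin.cons (T (u 1)) (fun i : Fin m =>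
        scaledCurvature T S t (u ⟨2 * i + 2, by omega⟩) (u ⟨2 * i + 3, by omega⟩)))
    rw [Fin.sum_univ_succ] at this
    simp only [Fin.cons_zero, Fin.cons_succ, Fin.update_cons_zero, ← Fin.cons_update] at this
    simp only [Fin.cons_update, ContinuousMultilinearMap.map_update_smul, ← Finset.smul_sum]
    simp only [← Fin.cons_update]
    rw [eq_neg_of_add_eq_zero_left this]
    module
  rw [funext h2]
  -- `S (u 0) (u 1)` may be replaced by `½ dθ(u 0, u 1)` under the alternating sum
  have h3 : altSum (fun u : Fin (2 * m + 1 + 1) → E =>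
      Q (Fin.cons (S (u 1) (u 0)) (fun i : Fin m =>
        scaledCurvature T S t (u ⟨2 * i + 2, by omega⟩) (u ⟨2 * i + 3, by omega⟩)))) v =
      -altSum (fun u : Fin (2 * m + 1 + 1) → E =>
      Q (Fin.cons (S (u 0) (u 1)) (fun i : Fin m =>
        scaledCurvature T S t (u ⟨2 * i + 2, by omega⟩) (u ⟨2 * i + 3, by omega⟩)))) v := by
    have hne : (0 : Fin (2 * m + 1 + 1)) ≠ 1 := by simp
    refine Eq.trans ?_ (altSum_comp_swap _ hne v)
    congr 1
  have h4 : ∀ u : Fin (2 * m + 1 + 1) → E,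
      Q (Fin.cons (scaledCurvatureDeriv T S t (u 0) (u 1)) (fun i : Fin m =>
        scaledCurvature T S t (u ⟨2 * i + 2, by omega⟩) (u ⟨2 * i + 3, by omega⟩)))
      = (Q (Fin.cons (S (u 0) (u 1)) (fun i : Fin m =>
        scaledCurvature T S t (u ⟨2 * i + 2, by omega⟩) (u ⟨2 * i + 3, by omega⟩)))
      + (-1 : ℝ) • Q (Fin.cons (S (u 1) (u 0)) (fun i : Fin m =>
        scaledCurvature T S t (u ⟨2 * i + 2, by omega⟩) (u ⟨2 * i + 3, by omega⟩))))
      + (2 * t) • Q (Fin.cons ⁅T (u 0), T (u 1)⁆ (fun i : Fin m =>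
        scaledCurvature T S t (u ⟨2 * i + 2, by omega⟩) (u ⟨2 * i + 3, by omega⟩))) := by
    intro u
    rw [scaledCurvatureDeriv, ContinuousMultilinearMap.cons_add,
      ContinuousMultilinearMap.cons_smul, sub_eq_add_neg, ContinuousMultilinearMap.cons_add,
      ← neg_one_smul ℝ (S (u 1) (u 0)), ContinuousMultilinearMap.cons_smul]
  rw [funext h4, altSum_add, altSum_add, altSum_smul, altSum_smul, altSum_smul, h3]
  module

theorem hasDirDeriv_smul_const {c : ℝ → ℝ} {c' t : ℝ} (h : HasDerivAt c c' t) (z : A) :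
    HasDirDeriv (fun s => c s • z) t 1 (c' • z) := by
  have h1 : HasDirDeriv c t 1 c' := by
    simpa [HasDirDeriv] using hasDerivAt_iff_tendsto_slope_zero.1 h
  simpa using h1.clm_comp (ContinuousLinearMap.toSpanSingleton ℝ z)

theorem hasDirDeriv_scaledCurvature (t : ℝ) (a b : E) :
    HasDirDeriv (fun t => scaledCurvature T S t a b) t 1 (scaledCurvatureDeriv T S t a b) := by
  have := (hasDirDeriv_smul_const (hasDerivAt_id t) (S a b - S b a)).add
    (hasDirDeriv_smul_const (hasDerivAt_pow 2 t) ⁅T a, T b⁆)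
  simpa [scaledCurvatureDeriv, scaledCurvature] using this

theorem continuous_scaledCurvature (a b : E) : Continuous fun t => scaledCurvature T S t a b := by
  unfold scaledCurvature; fun_prop

theorem continuous_scaledCurvatureDeriv (a b : E) :
    Continuous fun t => scaledCurvatureDeriv T S t a b := by
  unfold scaledCurvatureDeriv; fun_prop

theorem hasDirDeriv_altSum {E' W : Type*} [AddCommGroup E'] [Module ℝ E'] [AddCommGroup W]
    [Module ℝ W] [TopologicalSpace W] [ContinuousAdd W] [ContinuousConstSMul ℝ W] {N : ℕ}
    {F : E' → (Fin N → E) → W} {F' : (Fin N → E) → W} {x w : E'}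
    (h : ∀ u, HasDirDeriv (fun y => F y u) x w (F' u)) (v : Fin N → E) :
    HasDirDeriv (fun y => altSum (F y) v) x w (altSum F' v) :=
  HasDirDeriv.sum Finset.univ fun σ _ => (h (v ∘ σ)).const_smul ((Equiv.Perm.sign σ : ℤ) : ℝ)

/-- Integrating `d/dt Q(φ_t^l) = l Q(φ_t' ∧ φ_t^{l-1})` over the unit interval. -/
theorem integral_altSum_scaledCurvatureDeriv (hQ : IsInvariantPolynomial Q)
    (v : Fin (2 * m + 1 + 1) → E) :
    ((m + 1 : ℕ) : ℝ) • ∫ t in (0 : ℝ)..1, altSum (fun u : Fin (2 * m + 1 + 1) → E =>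
      Q (Fin.cons (scaledCurvatureDeriv T S t (u 0) (u 1)) (fun i : Fin m =>
        scaledCurvature T S t (u ⟨2 * i + 2, by omega⟩) (u ⟨2 * i + 3, by omega⟩)))) v
    = altSum (fun u : Fin (2 * m + 1 + 1) → E => Q (fun k : Fin (m + 1) =>
        scaledCurvature T S 1 (u ⟨2 * k, by omega⟩) (u ⟨2 * k + 1, by omega⟩))) v := by
  have hd : ∀ t : ℝ, HasDerivAt (fun t => altSum (fun u : Fin (2 * m + 1 + 1) → E =>
        Q (fun k : Fin (m + 1) =>
          scaledCurvature T S t (u ⟨2 * k, by omega⟩) (u ⟨2 * k + 1, by omega⟩))) v)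
      (((m + 1 : ℕ) : ℝ) • altSum (fun u : Fin (2 * m + 1 + 1) → E =>
      Q (Fin.cons (scaledCurvatureDeriv T S t (u 0) (u 1)) (fun i : Fin m =>
        scaledCurvature T S t (u ⟨2 * i + 2, by omega⟩) (u ⟨2 * i + 3, by omega⟩)))) v) t := by
    intro t
    have h0 : ∀ u : Fin (2 * m + 1 + 1) → E, HasDirDeriv (fun t => Q (fun k : Fin (m + 1) =>
        scaledCurvature T S t (u ⟨2 * k, by omega⟩) (u ⟨2 * k + 1, by omega⟩))) t 1
        (∑ i : Fin (m + 1), Q (Function.update (fun k : Fin (m + 1) => scaledCurvature T S t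
          (u ⟨2 * k, by omega⟩) (u ⟨2 * k + 1, by omega⟩)) i
          (scaledCurvatureDeriv T S t (u ⟨2 * i, by omega⟩) (u ⟨2 * i + 1, by omega⟩)))) :=
      fun u => HasDirDeriv.multilinear Q fun k => hasDirDeriv_scaledCurvature T S t _ _
    have h1 := hasDirDeriv_altSum h0 v
    have h2 := altSum_sum Finset.univ (fun (i : Fin (m + 1)) (u : Fin (2 * m + 1 + 1) → E) =>
      Q (Function.update (fun k : Fin (m + 1) => scaledCurvature T S t (u ⟨2 * k, by omega⟩)
        (u ⟨2 * k + 1, by omega⟩)) i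
        (scaledCurvatureDeriv T S t (u ⟨2 * i, by omega⟩) (u ⟨2 * i + 1, by omega⟩)))) v
    rw [Finset.sum_congr rfl fun i _ => altSum_update_pair Q hQ _ _ i v, Finset.sum_const,
      Finset.card_univ, Fintype.card_fin, ← Nat.cast_smul_eq_nsmul ℝ] at h2
    rw [← h2, hasDerivAt_iff_tendsto_slope_zero]
    simpa only [HasDirDeriv, smul_eq_mul, mul_one] using h1
  have hint : Continuous fun t => ((m + 1 : ℕ) : ℝ) • altSum (fun u : Fin (2 * m + 1 + 1) → E =>
      Q (Fin.cons (scaledCurvatureDeriv T S t (u 0) (u 1)) (fun i : Fin m =>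
        scaledCurvature T S t (u ⟨2 * i + 2, by omega⟩) (u ⟨2 * i + 3, by omega⟩)))) v := by
    refine Continuous.const_smul (continuous_finsetSum _ fun σ _ => Continuous.const_smul
      (Q.cont.comp (continuous_pi fun k => ?_)) _) _
    refine Fin.cases ?_ (fun k => ?_) k
    · simpa using continuous_scaledCurvatureDeriv T S _ _
    · simpa using continuous_scaledCurvature T S _ _
  rw [← intervalIntegral.integral_smul, intervalIntegral.integral_eq_sub_of_hasDerivAt
    (fun t _ => hd t) (hint.intervalIntegrable _ _)]
  -- `φ_0 = 0`, and `Q` has at least one argument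
  have h0 : altSum (fun u : Fin (2 * m + 1 + 1) → E => Q (fun k : Fin (m + 1) =>
        scaledCurvature T S 0 (u ⟨2 * k, by omega⟩) (u ⟨2 * k + 1, by omega⟩))) v = 0 := by
    refine Finset.sum_eq_zero fun σ _ => ?_
    beta_reduce
    rw [Q.map_coord_zero 0 (by simp [scaledCurvature]), smul_zero]
  rw [h0, sub_zero]

end TransgressionAlgebra

/-! ### Differential forms in charts -/

section ChartForms

universe u

theorem eventually_mem_transition {X Y : Type*} [TopologicalSpace X] [TopologicalSpace Y]
    {e e' : OpenPartialHomeomorph X Y} {y : Y} (hy : y ∈ e.target)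
    (hy' : e.symm y ∈ e'.source) : ∀ᶠ z in 𝓝 y, z ∈ e.target ∧ e.symm z ∈ e'.source :=
  (e.symm.trans e').open_source.mem_nhds ⟨hy, hy'⟩

theorem update_vec_one {X : Type*} (x z : X) : Function.update ![x] 0 z = ![z] := by
  funext i
  fin_cases i
  rfl

section

variable {E : Type u} [AddCommGroup E] [Module ℝ E] [TopologicalSpace E]
  {M : Type*} [TopologicalSpace M] [ChartedSpace E M] {W : Type*}

/-- The expression of a one-form in a chart, as a function of a point and a vector. -/
noncomputable def oneFormInChart (θ : M → (Fin 1 → E) → W) (e : OpenPartialHomeomorph M E)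
    (y w : E) : W :=
  formInChart θ e y ![w]

/-- Evaluation on push-forwards of vectors under the inverse chart, in the shape produced by
unfolding `formInChart` for products of forms. -/
theorem formInChart_apply_vec1 (θ : M → (Fin 1 → E) → W) (e : OpenPartialHomeomorph M E) (y w : E) :
    θ (e.symm y) ![dirDeriv (chartAt E (e.symm y) ∘ e.symm) y w] = oneFormInChart θ e y w := by
  simp only [oneFormInChart, formInChart]
  congr 1
  funext i
  simp

theorem formInChart_apply_vec2 (φ : M → (Fin 2 → E) → W) (e : OpenPartialHomeomorph M E)
    (y a b : E) :
    φ (e.symm y) ![dirDeriv (chartAt E (e.symm y) ∘ e.symm) y a,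
      dirDeriv (chartAt E (e.symm y) ∘ e.symm) y b] = formInChart φ e y ![a, b] := by
  simp only [formInChart]
  congr 1
  funext i
  fin_cases i <;> simp

variable [AddCommGroup W] [Module ℝ W] [TopologicalSpace W]

/-- The directional derivative `D_u θ_e(w)` of the expression `θ_e` of a one-form in a chart. -/
noncomputable def oneFormDeriv (θ : M → (Fin 1 → E) → W) (e : OpenPartialHomeomorph M E)
    (y u w : E) : W :=
  dirDeriv (fun z => oneFormInChart θ e z w) y u

theorem extDerivLC_oneForm (θ : M → (Fin 1 → E) → W) (q : M) (v : Fin 2 → E) :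
    extDerivLC θ q v = oneFormDeriv θ (chartAt E q) (chartAt E q q) (v 0) (v 1)
      - oneFormDeriv θ (chartAt E q) (chartAt E q q) (v 1) (v 0) := by
  have h0 : (0 : Fin 2).removeNth v = ![v 1] := by
    funext i; fin_cases i; rfl
  have h1 : (1 : Fin 2).removeNth v = ![v 0] := by
    funext i; fin_cases i; rfl
  simp [extDerivLC, Fin.sum_univ_two, h0, h1, oneFormDeriv, oneFormInChart, sub_eq_add_neg]

/-- The derivative in the base point alone is the derivative, in a horizontal direction, of the form
as a function of base point and vector. -/
theorem oneFormDeriv_eq_dirDeriv (θ : M → (Fin 1 → E) → W) (e : OpenPartialHomeomorph M E)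
    (y u w : E) :
    oneFormDeriv θ e y u w =
      dirDeriv (fun q : E × E => oneFormInChart θ e q.1 q.2) (y, w) (u, 0) := by
  simp [oneFormDeriv, dirDeriv]

end

section

variable {E : Type u} [AddCommGroup E] [Module ℝ E] [TopologicalSpace E]
  [IsTopologicalAddGroup E] [ContinuousSMul ℝ E]
  {M : Type*} [TopologicalSpace M] [ChartedSpace E M] {W : Type*}

/-- In the preferred chart at `p`, the expression of a form at `p` is the form itself. -/
theorem formInChart_chartAt [T2Space E] {k : ℕ} (α : M → (Fin k → E) → W) (p : M) (v : Fin k → E) :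
    formInChart α (chartAt E p) (chartAt E p p) v = α p v := by
  simp only [formInChart, (chartAt E p).left_inv (mem_chart_source E p)]
  congr 1
  funext i
  refine ((hasDirDeriv_id _ (v i)).congr_of_eventuallyEq ?_).dirDeriv_eq
  filter_upwards [(chartAt E p).open_target.mem_nhds (mem_chart_target E p)] with z hz
  simp [(chartAt E p).right_inv hz]

variable [AddCommGroup W] [Module ℝ W] [TopologicalSpace W]
  {θ : M → (Fin 1 → E) → W} {e : OpenPartialHomeomorph M E}

theorem IsSmoothForm.ckOn_oneFormInChart (hθ : IsSmoothForm θ) (he : e ∈ atlas E M) (k : ℕ) :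
    CkOn k (fun q : E × E => oneFormInChart θ e q.1 q.2) (e.target ×ˢ univ) := by
  have h := (hθ.smooth e he k).comp_clm ((ContinuousLinearMap.fst ℝ E E).prod
    (ContinuousLinearMap.pi fun _ => ContinuousLinearMap.snd ℝ E E))
  refine (h.congr ?_ ?_).mono (V := e.target ×ˢ univ) fun q hq => ⟨hq.1, mem_univ _⟩
  · exact (e.open_target.prod isOpen_univ).preimage (ContinuousLinearMap.continuous _)
  · intro q _
    simp only [oneFormInChart, ContinuousLinearMap.prod_apply]
    congr 1
    funext i
    simp

theorem IsSmoothForm.ckOn_oneFormInChart_const (hθ : IsSmoothForm θ) (he : e ∈ atlas E M) (k : ℕ)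
    (w : E) : CkOn k (fun y => oneFormInChart θ e y w) e.target := by
  have := (hθ.ckOn_oneFormInChart he k).comp_affine (ContinuousLinearMap.inl ℝ E E) (0, w)
  simp only [ContinuousLinearMap.inl_apply, Prod.mk_add_mk, add_zero, zero_add] at this
  exact this.mono fun y hy => ⟨hy, mem_univ _⟩

theorem IsSmoothForm.ckOn_oneFormInChart_apply (hθ : IsSmoothForm θ) (he : e ∈ atlas E M) (k : ℕ)
    {n : ℕ} (a : Fin n) :
    CkOn k (fun q : E × (Fin n → E) => oneFormInChart θ e q.1 (q.2 a)) (e.target ×ˢ univ) :=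
  ((hθ.ckOn_oneFormInChart he k).comp_clm ((ContinuousLinearMap.fst ℝ E (Fin n → E)).prod
    ((ContinuousLinearMap.proj a).comp (ContinuousLinearMap.snd ℝ E (Fin n → E))))).mono
    fun _ hq => ⟨hq.1, mem_univ _⟩

variable [IsTopologicalAddGroup W] [ContinuousSMul ℝ W] [LocallyConvexSpace ℝ W] [T2Space W]

theorem IsSmoothForm.hasDirDeriv_oneFormInChart (hθ : IsSmoothForm θ) (he : e ∈ atlas E M)
    {y : E} (hy : y ∈ e.target) (u w : E) :
    HasDirDeriv (fun z => oneFormInChart θ e z w) y u (oneFormDeriv θ e y u w) :=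
  ((hθ.ckOn_oneFormInChart_const he 1 w).hasStrictDirDeriv e.open_target hy u).hasDirDeriv

theorem IsSmoothForm.hasDirDeriv_oneFormDeriv (hθ : IsSmoothForm θ) (he : e ∈ atlas E M)
    {y : E} (hy : y ∈ e.target) (x a b : E) :
    HasDirDeriv (fun z => oneFormDeriv θ e z a b) y x
      (dirDeriv (fun z => oneFormDeriv θ e z a b) y x) :=
  (((hθ.ckOn_oneFormInChart_const he 2 b).dirDeriv_const_dir e.open_target a).hasStrictDirDeriv
    e.open_target hy x).hasDirDeriv

theorem IsSmoothForm.dirDeriv_oneFormDeriv_comm (hθ : IsSmoothForm θ) (he : e ∈ atlas E M)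
    {y : E} (hy : y ∈ e.target) (x a b : E) :
    dirDeriv (fun z => oneFormDeriv θ e z a b) y x
      = dirDeriv (fun z => oneFormDeriv θ e z x b) y a :=
  (hθ.ckOn_oneFormInChart_const he 2 b).dirDeriv_comm e.open_target hy a x

theorem oneFormDeriv_add_left (hθ : IsSmoothForm θ) (he : e ∈ atlas E M)
    {y : E} (hy : y ∈ e.target) (u u' w : E) :
    oneFormDeriv θ e y (u + u') w = oneFormDeriv θ e y u w + oneFormDeriv θ e y u' w :=
  (hθ.ckOn_oneFormInChart_const he 1 w).dirDeriv_add e.open_target hy u u'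

theorem oneFormDeriv_smul_left (hθ : IsSmoothForm θ) (he : e ∈ atlas E M)
    {y : E} (hy : y ∈ e.target) (c : ℝ) (u w : E) :
    oneFormDeriv θ e y (c • u) w = c • oneFormDeriv θ e y u w :=
  (hθ.ckOn_oneFormInChart_const he 1 w).dirDeriv_smul e.open_target hy c u

end

variable {E : Type u} [AddCommGroup E] [Module ℝ E] [TopologicalSpace E]
  [IsTopologicalAddGroup E] [ContinuousSMul ℝ E] [LocallyConvexSpace ℝ E] [T2Space E]
  {M : Type*} [TopologicalSpace M] [ChartedSpace E M]
  {W : Type*}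

theorem IsLCManifold.hasStrictDirDeriv (hM : IsLCManifold E M) {e e' : OpenPartialHomeomorph M E}
    (he : e ∈ atlas E M) (he' : e' ∈ atlas E M) {y : E} (hy : y ∈ e.target)
    (hy' : e.symm y ∈ e'.source) (w : E) :
    HasStrictDirDeriv (e' ∘ e.symm) y w (dirDeriv (e' ∘ e.symm) y w) :=
  (hM e he e' he' 1).hasStrictDirDeriv (e.symm.trans e').open_source ⟨hy, hy'⟩ w

theorem dirDeriv_chart_cocycle (hM : IsLCManifold E M) {e e' e'' : OpenPartialHomeomorph M E}
    (he : e ∈ atlas E M) (he' : e' ∈ atlas E M) (he'' : e'' ∈ atlas E M) {y : E}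
    (hy : y ∈ e.target) (hy' : e.symm y ∈ e'.source) (hy'' : e.symm y ∈ e''.source) (w : E) :
    dirDeriv (e'' ∘ e.symm) y w =
      dirDeriv (e'' ∘ e'.symm) (e' (e.symm y)) (dirDeriv (e' ∘ e.symm) y w) := by
  have h1 := hM.hasStrictDirDeriv he' he'' (e'.map_source hy')
    (by rwa [e'.left_inv hy']) (dirDeriv (e' ∘ e.symm) y w)
  have h2 := HasStrictDirDeriv.comp_hasDirDeriv (f := e' ∘ e.symm) h1
    (hM.hasStrictDirDeriv he he' hy hy' w).hasDirDeriv
  refine (h2.congr_of_eventuallyEq ?_).dirDeriv_eq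
  filter_upwards [eventually_mem_transition hy hy'] with z hz
  simp [e'.left_inv hz.2]

/-- The transformation rule for the expressions of a form in two charts. -/
theorem formInChart_transition (hM : IsLCManifold E M) {k : ℕ} (α : M → (Fin k → E) → W)
    {e e' : OpenPartialHomeomorph M E} (he : e ∈ atlas E M) (he' : e' ∈ atlas E M) {y : E}
    (hy : y ∈ e.target) (hy' : e.symm y ∈ e'.source) (v : Fin k → E) :
    formInChart α e y v =
      formInChart α e' (e' (e.symm y)) (fun i => dirDeriv (e' ∘ e.symm) y (v i)) := by
  simp only [formInChart, e'.left_inv hy']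
  congr 1
  funext i
  exact dirDeriv_chart_cocycle hM he he' (chart_mem_atlas E _) hy hy' (mem_chart_source E _) _

variable [AddCommGroup W] [Module ℝ W] [TopologicalSpace W]
  {θ : M → (Fin 1 → E) → W} {e : OpenPartialHomeomorph M E}

theorem oneFormInChart_add (hM : IsLCManifold E M) (hθ : IsSmoothForm θ) (he : e ∈ atlas E M)
    {y : E} (hy : y ∈ e.target) (a b : E) :
    oneFormInChart θ e y (a + b) = oneFormInChart θ e y a + oneFormInChart θ e y b := by
  obtain ⟨β, hβ⟩ := hθ.alternating (e.symm y)
  have h := (hM e he _ (chart_mem_atlas E (e.symm y)) 1).dirDeriv_add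
    (e.symm.trans (chartAt E (e.symm y))).open_source ⟨hy, mem_chart_source E _⟩ a b
  simp only [OpenPartialHomeomorph.coe_trans] at h
  simp only [← formInChart_apply_vec1, hβ, h]
  simpa only [update_vec_one] using β.map_update_add ![0] 0
    (dirDeriv (chartAt E (e.symm y) ∘ e.symm) y a)
    (dirDeriv (chartAt E (e.symm y) ∘ e.symm) y b)

theorem oneFormInChart_smul (hM : IsLCManifold E M) (hθ : IsSmoothForm θ) (he : e ∈ atlas E M)
    {y : E} (hy : y ∈ e.target) (c : ℝ) (a : E) :
    oneFormInChart θ e y (c • a) = c • oneFormInChart θ e y a := by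
  obtain ⟨β, hβ⟩ := hθ.alternating (e.symm y)
  have h := (hM e he _ (chart_mem_atlas E (e.symm y)) 1).dirDeriv_smul
    (e.symm.trans (chartAt E (e.symm y))).open_source ⟨hy, mem_chart_source E _⟩ c a
  simp only [OpenPartialHomeomorph.coe_trans] at h
  simp only [← formInChart_apply_vec1, hβ, h]
  simpa only [update_vec_one] using β.map_update_smul ![0] 0 c
    (dirDeriv (chartAt E (e.symm y) ∘ e.symm) y a)

variable [IsTopologicalAddGroup W] [ContinuousSMul ℝ W] [LocallyConvexSpace ℝ W] [T2Space W]

theorem oneFormDeriv_add_right (hM : IsLCManifold E M) (hθ : IsSmoothForm θ) (he : e ∈ atlas E M)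
    {y : E} (hy : y ∈ e.target) (u w w' : E) :
    oneFormDeriv θ e y u (w + w') = oneFormDeriv θ e y u w + oneFormDeriv θ e y u w' := by
  refine (((hθ.hasDirDeriv_oneFormInChart he hy u w).add
    (hθ.hasDirDeriv_oneFormInChart he hy u w')).congr_of_eventuallyEq ?_).dirDeriv_eq
  filter_upwards [e.open_target.mem_nhds hy] with z hz
  exact oneFormInChart_add hM hθ he hz w w'

theorem oneFormDeriv_smul_right (hM : IsLCManifold E M) (hθ : IsSmoothForm θ) (he : e ∈ atlas E M)
    {y : E} (hy : y ∈ e.target) (c : ℝ) (u w : E) :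
    oneFormDeriv θ e y u (c • w) = c • oneFormDeriv θ e y u w := by
  refine (((hθ.hasDirDeriv_oneFormInChart he hy u w).const_smul c).congr_of_eventuallyEq
    ?_).dirDeriv_eq
  filter_upwards [e.open_target.mem_nhds hy] with z hz
  exact oneFormInChart_smul hM hθ he hz c w

/-- Transformation of the derivative of a one-form under a change of charts `τ`: besides the
tensorial term there is the term `θ(D²τ(u, w))`, which is symmetric in `u` and `w`. -/
theorem oneFormDeriv_transition (hM : IsLCManifold E M) (hθ : IsSmoothForm θ)
    {e' : OpenPartialHomeomorph M E} (he : e ∈ atlas E M) (he' : e' ∈ atlas E M) {y : E}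
    (hy : y ∈ e.target) (hy' : e.symm y ∈ e'.source) (u w : E) :
    oneFormDeriv θ e y u w = oneFormDeriv θ e' (e' (e.symm y)) (dirDeriv (e' ∘ e.symm) y u)
        (dirDeriv (e' ∘ e.symm) y w)
      + oneFormInChart θ e' (e' (e.symm y))
        (dirDeriv (fun z => dirDeriv (e' ∘ e.symm) z w) y u) := by
  set τ := e' ∘ e.symm with hτ
  have hU := (e.symm.trans e').open_source
  have hyU : y ∈ (e.symm.trans e').source := ⟨hy, hy'⟩
  have hτy : τ y ∈ e'.target := e'.map_source hy'
  have hT : IsOpen (e'.target ×ˢ (univ : Set E)) := e'.open_target.prod isOpen_univ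
  have hJ := hθ.ckOn_oneFormInChart he' 1
  have hmem : (τ y, dirDeriv τ y w) ∈ e'.target ×ˢ (univ : Set E) := ⟨hτy, mem_univ _⟩
  have h1 : HasDirDeriv (fun z => dirDeriv τ z w) y u (dirDeriv (fun z => dirDeriv τ z w) y u) :=
    (((hM e he e' he' 2).dirDeriv_const_dir hU w).hasStrictDirDeriv hU hyU u).hasDirDeriv
  have h2 := (hM.hasStrictDirDeriv he he' hy hy' u).hasDirDeriv.prodMk h1
  have h3 := HasStrictDirDeriv.comp_hasDirDeriv (f := fun z => (τ z, dirDeriv τ z w))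
    (hJ.hasStrictDirDeriv hT hmem _) h2
  have h4 : (fun z => oneFormInChart θ e z w)
      =ᶠ[𝓝 y] fun z => oneFormInChart θ e' (τ z) (dirDeriv τ z w) := by
    filter_upwards [eventually_mem_transition hy hy'] with z hz
    rw [oneFormInChart, formInChart_transition hM θ he he' hz.1 hz.2]
    simp only [oneFormInChart]
    congr 1
    funext i
    fin_cases i
    rfl
  -- the derivative in the direction of the vector argument, by linearity in that argument
  have h5 : HasDirDeriv (fun q : E × E => oneFormInChart θ e' q.1 q.2) (τ y, dirDeriv τ y w)
      (0, dirDeriv (fun z => dirDeriv τ z w) y u)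
      (oneFormInChart θ e' (τ y) (dirDeriv (fun z => dirDeriv τ z w) y u)) := by
    refine Tendsto.congr' ?_ tendsto_const_nhds
    filter_upwards [self_mem_nhdsWithin] with t (ht : t ≠ 0)
    simp only [Prod.smul_mk, smul_zero, Prod.mk_add_mk, add_zero]
    rw [oneFormInChart_add hM hθ he' hτy, oneFormInChart_smul hM hθ he' hτy, add_sub_cancel_left,
      inv_smul_smul₀ ht]
  have h6 := hJ.dirDeriv_add hT hmem (dirDeriv τ y u, 0)
    (0, dirDeriv (fun z => dirDeriv τ z w) y u)
  rw [Prod.mk_add_mk, add_zero, zero_add, h5.dirDeriv_eq, ← oneFormDeriv_eq_dirDeriv] at h6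
  exact (h3.congr_of_eventuallyEq h4).dirDeriv_eq.trans h6

/-- The exterior derivative of a one-form has the same expression in every chart. -/
theorem formInChart_extDerivLC (hM : IsLCManifold E M) (hθ : IsSmoothForm θ) (he : e ∈ atlas E M)
    {y : E} (hy : y ∈ e.target) (v : Fin 2 → E) :
    formInChart (extDerivLC θ) e y v
      = oneFormDeriv θ e y (v 0) (v 1) - oneFormDeriv θ e y (v 1) (v 0) := by
  have hc := chart_mem_atlas E (e.symm y)
  have hs := mem_chart_source E (e.symm y)
  rw [oneFormDeriv_transition hM hθ he hc hy hs (v 0) (v 1),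
    oneFormDeriv_transition hM hθ he hc hy hs (v 1) (v 0), formInChart, extDerivLC_oneForm]
  have := (hM e he _ hc 2).dirDeriv_comm (e.symm.trans _).open_source ⟨hy, hs⟩ (v 0) (v 1)
  simp only [OpenPartialHomeomorph.coe_trans] at this
  rw [this]
  abel

end ChartForms

/-! ### The transgression form in a chart -/

section TransgressionFactors

variable {A : Type*} [Ring A] [Algebra ℝ A] {E : Type*} (T : E → A) (S : E → E → A) {m : ℕ}

/-- The arguments `(θ(w₀), φ_t(w₁, w₂), …, φ_t(w_{2m-1}, w_{2m}))` of `Q` in `Q(θ ∧ φ_t^m)`. -/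
def transgressionFactors (t : ℝ) (w : Fin (2 * m + 1) → E) : Fin (m + 1) → A :=
  Fin.cons (T (w 0)) fun i : Fin m =>
    scaledCurvature T S t (w ⟨2 * i + 1, by omega⟩) (w ⟨2 * i + 2, by omega⟩)

open Classical in
/-- The coefficient two-form `dθ` of `t` in `φ_t` if `b` holds, the coefficient `½ [θ, θ]` of
`t²` otherwise. -/
noncomputable def curvatureCoeff (b : Prop) (x y : E) : A :=
  if b then S x y - S y x else ⁅T x, T y⁆

/-- The arguments of the summand of `Q(θ ∧ φ_t^m)` in which `dθ` is taken from the factors in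
`s` and `½ [θ, θ]` from the others. -/
noncomputable def transgressionCoeff (s : Finset (Fin m)) (w : Fin (2 * m + 1) → E) :
    Fin (m + 1) → A :=
  Fin.cons (T (w 0)) fun i : Fin m =>
    curvatureCoeff T S (i ∈ s) (w ⟨2 * i + 1, by omega⟩) (w ⟨2 * i + 2, by omega⟩)

/-- The power of `t` belonging to `transgressionCoeff s`. -/
def transgressionMonomial (s : Finset (Fin m)) (t : ℝ) : ℝ :=
  ∏ i : Fin m, if i ∈ s then t else t ^ 2

theorem continuous_transgressionMonomial (s : Finset (Fin m)) :
    Continuous (transgressionMonomial s) := by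
  refine continuous_finsetProd _ fun i _ => ?_
  split_ifs <;> fun_prop

variable [TopologicalSpace A] {𝕂 : Type*} [RCLike 𝕂]
  (Q : ContinuousMultilinearMap ℝ (fun _ : Fin (m + 1) => A) 𝕂)

/-- `Q(θ ∧ φ_t^m)` is a polynomial in `t`. -/
theorem transgressionFactors_expand (t : ℝ) (w : Fin (2 * m + 1) → E) :
    Q (transgressionFactors T S t w)
      = ∑ s : Finset (Fin m), transgressionMonomial s t • Q (transgressionCoeff T S s w) := by
  have h1 := (Q.toMultilinearMap.curryLeft (T (w 0))).map_add_univ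
    (fun i : Fin m => t • curvatureCoeff T S True (w ⟨2 * i + 1, by omega⟩)
      (w ⟨2 * i + 2, by omega⟩))
    (fun i : Fin m => t ^ 2 • curvatureCoeff T S False (w ⟨2 * i + 1, by omega⟩)
      (w ⟨2 * i + 2, by omega⟩))
  have h2 : Q (transgressionFactors T S t w) = Q.toMultilinearMap.curryLeft (T (w 0))
    ((fun i : Fin m => t • curvatureCoeff T S True (w ⟨2 * i + 1, by omega⟩)
      (w ⟨2 * i + 2, by omega⟩)) +
    (fun i : Fin m => t ^ 2 • curvatureCoeff T S False (w ⟨2 * i + 1, by omega⟩)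
      (w ⟨2 * i + 2, by omega⟩))) := by
    simp only [curvatureCoeff, if_true, if_false]
    rfl
  rw [h2, h1]
  refine Finset.sum_congr rfl fun s _ => ?_
  have h3 : s.piecewise
      (fun i : Fin m => t • curvatureCoeff T S True (w ⟨2 * i + 1, by omega⟩)
        (w ⟨2 * i + 2, by omega⟩))
      (fun i : Fin m => t ^ 2 • curvatureCoeff T S False (w ⟨2 * i + 1, by omega⟩)
        (w ⟨2 * i + 2, by omega⟩))
      = fun i => (if i ∈ s then t else t ^ 2) •
        curvatureCoeff T S (i ∈ s) (w ⟨2 * i + 1, by omega⟩) (w ⟨2 * i + 2, by omega⟩) := by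
    funext i
    by_cases hi : i ∈ s <;> simp [hi, Finset.piecewise]
  rw [h3, MultilinearMap.map_smul_univ]
  rfl

theorem altSum_transgressionFactors (t : ℝ) (v : Fin (2 * m + 1) → E) :
    altSum (fun w => Q (transgressionFactors T S t w)) v
      = ∑ s : Finset (Fin m), transgressionMonomial s t •
        altSum (fun w => Q (transgressionCoeff T S s w)) v := by
  simp only [transgressionFactors_expand]
  rw [altSum_sum]
  simp only [altSum_smul]

theorem integral_sum_smul {ι : Type*} [Fintype ι] {c : ι → ℝ → ℝ} (hc : ∀ i, Continuous (c i))
    (X : ι → 𝕂) : ∫ t in (0 : ℝ)..1, ∑ i, c i t • X i = ∑ i, (∫ t in (0 : ℝ)..1, c i t) • X i := by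
  rw [intervalIntegral.integral_finsetSum]
  · simp only [intervalIntegral.integral_smul_const]
  · intro i _
    exact ((hc i).smul continuous_const).intervalIntegrable _ _

/-- Differentiation under the integral sign for a family depending polynomially on the
parameter. -/
theorem hasDirDeriv_integral {X : Type*} [AddCommGroup X] [Module ℝ X] [TopologicalSpace X]
    [ContinuousAdd X] [ContinuousSMul ℝ X] {ι : Type*} [Fintype ι] {c : ι → ℝ → ℝ}
    (hc : ∀ i, Continuous (c i)) {F : ℝ → X → 𝕂} {G : ι → X → 𝕂} {F' : ℝ → 𝕂} {G' : ι → 𝕂}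
    {x v : X} (hF : ∀ᶠ y in 𝓝 x, ∀ t, F t y = ∑ i, c i t • G i y)
    (hG : ∀ i, HasDirDeriv (G i) x v (G' i)) (hF' : ∀ t, HasDirDeriv (F t) x v (F' t)) :
    HasDirDeriv (fun y => ∫ t in (0 : ℝ)..1, F t y) x v (∫ t in (0 : ℝ)..1, F' t) := by
  have h1 : ∀ t, F' t = ∑ i, c i t • G' i := fun t =>
    (hF' t).unique ((HasDirDeriv.sum Finset.univ fun i _ =>
      (hG i).const_smul (c i t)).congr_of_eventuallyEq (hF.mono fun y hy => hy t))
  simp only [h1]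
  rw [integral_sum_smul hc]
  refine (HasDirDeriv.sum Finset.univ fun i _ =>
    (hG i).const_smul (∫ t in (0 : ℝ)..1, c i t)).congr_of_eventuallyEq (hF.mono fun y hy => ?_)
  simp only [hy]
  exact integral_sum_smul hc _

end TransgressionFactors

/-! ### Multilinearity of the coefficients -/

section Multilinearity

variable {A : Type*} [Ring A] [Algebra ℝ A] {m : ℕ} {E : Type*} [AddCommGroup E] [Module ℝ E]

/-- Each argument of `w ↦ (T(w₀), B₁(w₁, w₂), …, B_m(w_{2m-1}, w_{2m}))` enters exactly one
component, and linearly. -/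
theorem exists_update_cons_pairs (T : E →ₗ[ℝ] A) (B : Fin m → E →ₗ[ℝ] E →ₗ[ℝ] A)
    [DecidableEq (Fin (2 * m + 1))] (w : Fin (2 * m + 1) → E) (j : Fin (2 * m + 1)) :
    ∃ (k : Fin (m + 1)) (ℓ : E →ₗ[ℝ] A), ∀ x,
      (Fin.cons (T (Function.update w j x 0)) fun i : Fin m =>
        B i (Function.update w j x ⟨2 * i + 1, by omega⟩)
          (Function.update w j x ⟨2 * i + 2, by omega⟩) : Fin (m + 1) → A)
      = Function.update (Fin.cons (T (w 0)) fun i : Fin m =>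
        B i (w ⟨2 * i + 1, by omega⟩) (w ⟨2 * i + 2, by omega⟩)) k (ℓ x) := by
  -- `0` belongs to the component `0`, while `2i + 1` and `2i + 2` belong to the component `i + 1`
  obtain ⟨j, hj⟩ := j
  rcases Nat.even_or_odd' j with ⟨i, rfl | rfl⟩
  · rcases Nat.eq_zero_or_pos i with rfl | hi
    · refine ⟨0, T, fun x => ?_⟩
      rw [Fin.update_cons_zero]
      congr 1
      · exact congrArg T (Function.update_self _ _ _)
      · funext k
        rw [Function.update_of_ne (by simp [Fin.ext_iff]),
          Function.update_of_ne (by simp [Fin.ext_iff])]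
    · obtain ⟨i, rfl⟩ : ∃ k, i = k + 1 := ⟨i - 1, by omega⟩
      refine ⟨Fin.succ ⟨i, by omega⟩, B ⟨i, by omega⟩ (w ⟨2 * i + 1, by omega⟩), fun x => ?_⟩
      rw [← Fin.cons_update]
      congr 1
      · rw [Function.update_of_ne (by simp [Fin.ext_iff])]
      · funext k
        rw [Function.update_of_ne (by simp only [Ne, Fin.ext_iff]; omega)]
        by_cases hk : k = ⟨i, by omega⟩
        · subst hk
          rw [Function.update_self]
          exact congrArg _ (Function.update_self _ _ _)
        · rw [Function.update_of_ne hk, Function.update_of_ne]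
          simp only [Ne, Fin.ext_iff] at hk ⊢
          omega
  · refine ⟨Fin.succ ⟨i, by omega⟩, (B ⟨i, by omega⟩).flip (w ⟨2 * i + 2, by omega⟩), fun x => ?_⟩
    rw [← Fin.cons_update]
    congr 1
    · rw [Function.update_of_ne (by simp [Fin.ext_iff])]
    · funext k
      rw [Function.update_of_ne (a := (⟨2 * k + 2, _⟩ : Fin (2 * m + 1)))
        (by simp only [Ne, Fin.ext_iff]; omega)]
      by_cases hk : k = ⟨i, by omega⟩
      · subst hk
        rw [Function.update_self, Function.update_self, LinearMap.flip_apply]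
      · rw [Function.update_of_ne hk, Function.update_of_ne]
        simp only [Ne, Fin.ext_iff] at hk ⊢
        omega

variable [TopologicalSpace A] {𝕂 : Type*} [RCLike 𝕂]

/-- The multilinear map `w ↦ Q(T(w₀), B₁(w₁, w₂), …, B_m(w_{2m-1}, w_{2m}))`. -/
noncomputable def pairingMultilinear (Q : ContinuousMultilinearMap ℝ (fun _ : Fin (m + 1) => A) 𝕂)
    (T : E →ₗ[ℝ] A) (B : Fin m → E →ₗ[ℝ] E →ₗ[ℝ] A) :
    MultilinearMap ℝ (fun _ : Fin (2 * m + 1) => E) 𝕂 where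
  toFun w := Q (Fin.cons (T (w 0)) fun i : Fin m =>
    B i (w ⟨2 * i + 1, by omega⟩) (w ⟨2 * i + 2, by omega⟩))
  map_update_add' w j x y := by
    obtain ⟨k, ℓ, h⟩ := exists_update_cons_pairs T B w j
    simp only [h, map_add, ContinuousMultilinearMap.map_update_add]
  map_update_smul' w j c x := by
    obtain ⟨k, ℓ, h⟩ := exists_update_cons_pairs T B w j
    simp only [h, map_smul, ContinuousMultilinearMap.map_update_smul]

theorem alternatization_apply_eq_altSum {n : ℕ} (F : MultilinearMap ℝ (fun _ : Fin n => E) 𝕂)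
    (v : Fin n → E) : MultilinearMap.alternatization F v = altSum F v := by
  rw [MultilinearMap.alternatization_apply, altSum]
  refine Finset.sum_congr rfl fun σ _ => ?_
  rcases Int.units_eq_one_or (Equiv.Perm.sign σ) with h | h <;>
    simp [h, MultilinearMap.domDomCongr_apply, Function.comp_def]

/-- If `T` is linear and `S` bilinear, the alternating sum of a coefficient of `Q(θ ∧ φ_t^m)` is an
alternating multilinear map. -/
theorem exists_alternating_transgressionCoeff
    (Q : ContinuousMultilinearMap ℝ (fun _ : Fin (m + 1) => A) 𝕂) {T : E → A} {S : E → E → A}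
    (hT : ∀ a b, T (a + b) = T a + T b) (hT' : ∀ (c : ℝ) a, T (c • a) = c • T a)
    (hS : ∀ a b w, S (a + b) w = S a w + S b w) (hS' : ∀ (c : ℝ) a w, S (c • a) w = c • S a w)
    (hS₂ : ∀ a w w', S a (w + w') = S a w + S a w')
    (hS₂' : ∀ (c : ℝ) a w, S a (c • w) = c • S a w) (s : Finset (Fin m)) :
    ∃ β : E [⋀^Fin (2 * m + 1)]→ₗ[ℝ] 𝕂, ∀ v,
      altSum (fun w => Q (transgressionCoeff T S s w)) v = β v := by
  have hB : ∀ b : Prop, ∃ B : E →ₗ[ℝ] E →ₗ[ℝ] A, ∀ x y, B x y = curvatureCoeff T S b x y := by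
    intro b
    by_cases hb : b
    · refine ⟨LinearMap.mk₂ ℝ (fun x y => S x y - S y x) ?_ ?_ ?_ ?_, fun x y => ?_⟩
      · intro a b w; rw [hS, hS₂]; abel
      · intro c a w; rw [hS', hS₂', smul_sub]
      · intro a b w; rw [hS, hS₂]; abel
      · intro c a w; rw [hS', hS₂', smul_sub]
      · simp [curvatureCoeff, hb]
    · refine ⟨LinearMap.mk₂ ℝ (fun x y => ⁅T x, T y⁆) ?_ ?_ ?_ ?_, fun x y => ?_⟩
      · intro a b w; rw [hT]; simp only [Ring.lie_def]; noncomm_ring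
      · intro c a w; simp [hT', Ring.lie_def, smul_sub]
      · intro a b w; rw [hT]; simp only [Ring.lie_def]; noncomm_ring
      · intro c a w; simp [hT', Ring.lie_def, smul_sub]
      · simp [curvatureCoeff, hb]
  choose B hB using hB
  refine ⟨MultilinearMap.alternatization (pairingMultilinear Q
    { toFun := T, map_add' := hT, map_smul' := hT' } fun i => B (i ∈ s)), fun v => ?_⟩
  rw [alternatization_apply_eq_altSum]
  congr 1
  funext w
  simp only [pairingMultilinear, MultilinearMap.coe_mk, hB]
  rfl

end Multilinearity

/-! ### Smoothness and exterior derivative of the transgression form -/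

section Transgression

universe u

variable {A : Type*} [Ring A] [Algebra ℝ A] [TopologicalSpace A] [ContinuousInverseAlgebra A]
  {E : Type u} [AddCommGroup E] [Module ℝ E] [TopologicalSpace E]
  [IsTopologicalAddGroup E] [ContinuousSMul ℝ E]
  {M : Type*} [TopologicalSpace M] [ChartedSpace E M]
  {θ : M → (Fin 1 → E) → A} {e : OpenPartialHomeomorph M E}
  {m : ℕ} {𝕂 : Type*} [RCLike 𝕂] (Q : ContinuousMultilinearMap ℝ (fun _ : Fin (m + 1) => A) 𝕂)

theorem hasDirDeriv_scaledCurvature_chart (hθ : IsSmoothForm θ) (he : e ∈ atlas E M) {y : E}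
    (hy : y ∈ e.target) (t : ℝ) (x a b : E) :
    HasDirDeriv (fun z => scaledCurvature (oneFormInChart θ e z) (oneFormDeriv θ e z) t a b) y x
      (scaledCurvatureDirDeriv (oneFormInChart θ e y) (oneFormDeriv θ e y)
        (fun x a b => dirDeriv (fun z => oneFormDeriv θ e z a b) y x) t x a b) := by
  have h1 := ((hθ.hasDirDeriv_oneFormDeriv he hy x a b).add
    ((hθ.hasDirDeriv_oneFormDeriv he hy x b a).const_smul (-1))).const_smul t
  have h2 := ((hθ.hasDirDeriv_oneFormInChart he hy x a).lie
    (hθ.hasDirDeriv_oneFormInChart he hy x b)).const_smul (t ^ 2)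
  have h := h1.add h2
  simp only [neg_one_smul, ← sub_eq_add_neg] at h
  exact h

theorem hasDirDeriv_transgressionFactors (hθ : IsSmoothForm θ) (he : e ∈ atlas E M) {y : E}
    (hy : y ∈ e.target) (t : ℝ) (x : E) (w : Fin (2 * m + 1) → E) :
    HasDirDeriv (fun z => Q (transgressionFactors (oneFormInChart θ e z) (oneFormDeriv θ e z) t w))
      y x
      (Q (Fin.cons (oneFormDeriv θ e y x (w 0)) (fun i : Fin m =>
        scaledCurvature (oneFormInChart θ e y) (oneFormDeriv θ e y) t (w ⟨2 * i + 1, by omega⟩)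
          (w ⟨2 * i + 2, by omega⟩))) +
      ∑ j : Fin m, Q (Fin.cons (oneFormInChart θ e y (w 0)) (Function.update (fun i : Fin m =>
        scaledCurvature (oneFormInChart θ e y) (oneFormDeriv θ e y) t (w ⟨2 * i + 1, by omega⟩)
          (w ⟨2 * i + 2, by omega⟩)) j
        (scaledCurvatureDirDeriv (oneFormInChart θ e y) (oneFormDeriv θ e y)
          (fun x a b => dirDeriv (fun z => oneFormDeriv θ e z a b) y x) t x
          (w ⟨2 * j + 1, by omega⟩) (w ⟨2 * j + 2, by omega⟩))))) := by
  have h : ∀ k : Fin (m + 1), HasDirDeriv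
      (fun z => transgressionFactors (oneFormInChart θ e z) (oneFormDeriv θ e z) t w k) y x
      ((Fin.cons (oneFormDeriv θ e y x (w 0)) fun j : Fin m =>
        scaledCurvatureDirDeriv (oneFormInChart θ e y) (oneFormDeriv θ e y)
          (fun x a b => dirDeriv (fun z => oneFormDeriv θ e z a b) y x) t x
          (w ⟨2 * j + 1, by omega⟩) (w ⟨2 * j + 2, by omega⟩) : Fin (m + 1) → A) k) := by
    intro k
    refine Fin.cases ?_ (fun k => ?_) k
    · exact hθ.hasDirDeriv_oneFormInChart he hy x (w 0)
    · exact hasDirDeriv_scaledCurvature_chart hθ he hy t x _ _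
  have h1 := HasDirDeriv.multilinear Q h
  rw [Fin.sum_univ_succ] at h1
  simp only [Fin.cons_zero, Fin.cons_succ] at h1
  simp only [transgressionFactors, Fin.update_cons_zero, ← Fin.cons_update] at h1 ⊢
  exact h1

section Smoothness

variable {n : ℕ}

theorem IsSmoothForm.ckOn_oneFormDeriv_apply (hθ : IsSmoothForm θ) (he : e ∈ atlas E M) (k : ℕ)
    (a b : Fin n) :
    CkOn k (fun q : E × (Fin n → E) => oneFormDeriv θ e q.1 (q.2 a) (q.2 b))
      (e.target ×ˢ univ) := by
  simp only [oneFormDeriv_eq_dirDeriv]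
  exact (((hθ.ckOn_oneFormInChart he (k + 1)).ckOn_dirDeriv
    (e.open_target.prod isOpen_univ)).comp_clm
    (((ContinuousLinearMap.fst ℝ E (Fin n → E)).prod
      ((ContinuousLinearMap.proj b).comp (ContinuousLinearMap.snd ℝ E (Fin n → E)))).prod
      (((ContinuousLinearMap.proj a).comp (ContinuousLinearMap.snd ℝ E (Fin n → E))).prod 0))).mono
    fun _ hq => ⟨⟨hq.1, mem_univ _⟩, mem_univ _⟩

theorem IsSmoothForm.ckOn_curvatureCoeff (hθ : IsSmoothForm θ) (he : e ∈ atlas E M) (k : ℕ)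
    (p : Prop) (a b : Fin n) :
    CkOn k (fun q : E × (Fin n → E) => curvatureCoeff (oneFormInChart θ e q.1)
      (oneFormDeriv θ e q.1) p (q.2 a) (q.2 b)) (e.target ×ˢ univ) := by
  by_cases hp : p
  · have := (hθ.ckOn_oneFormDeriv_apply he k a b).lincomb 1 (-1)
      (hθ.ckOn_oneFormDeriv_apply he k b a)
    simpa only [curvatureCoeff, hp, if_true, one_smul, neg_one_smul, ← sub_eq_add_neg] using this
  · have ha := hθ.ckOn_oneFormInChart_apply he k a
    have hb := hθ.ckOn_oneFormInChart_apply he k b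
    have := (ha.mul hb).lincomb 1 (-1) (hb.mul ha)
    simpa only [curvatureCoeff, hp, if_false, one_smul, neg_one_smul, ← sub_eq_add_neg,
      Ring.lie_def] using this

theorem IsSmoothForm.ckOn_transgressionCoeff (hθ : IsSmoothForm θ) (he : e ∈ atlas E M) (k : ℕ)
    (s : Finset (Fin m)) :
    CkOn k (fun q : E × (Fin (2 * m + 1) → E) => altSum (fun w => Q (transgressionCoeff
      (oneFormInChart θ e q.1) (oneFormDeriv θ e q.1) s w)) q.2) (e.target ×ˢ univ) := by
  refine CkOn.sum_smul Finset.univ _ fun σ => CkOn.multilinear Q fun i => ?_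
  refine Fin.cases ?_ (fun i => ?_) i
  · exact hθ.ckOn_oneFormInChart_apply he k (σ 0)
  · exact hθ.ckOn_curvatureCoeff he k (i ∈ s) _ _

theorem IsSmoothForm.hasDirDeriv_transgressionCoeff (hθ : IsSmoothForm θ)
    (he : e ∈ atlas E M) {y : E} (hy : y ∈ e.target) (s : Finset (Fin m)) (x : E)
    (v : Fin (2 * m + 1) → E) :
    HasDirDeriv (fun z => altSum (fun w => Q (transgressionCoeff
      (oneFormInChart θ e z) (oneFormDeriv θ e z) s w)) v) y x (dirDeriv (fun z => altSum (fun w =>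
        Q (transgressionCoeff (oneFormInChart θ e z) (oneFormDeriv θ e z) s w)) v) y x) := by
  have := (hθ.ckOn_transgressionCoeff Q he 1 s).comp_affine
    (ContinuousLinearMap.inl ℝ E (Fin (2 * m + 1) → E)) (0, v)
  simp only [ContinuousLinearMap.inl_apply, Prod.mk_add_mk, add_zero, zero_add] at this
  exact ((this.mono (V := e.target) fun y hy => ⟨hy, mem_univ _⟩).hasStrictDirDeriv
    e.open_target hy x).hasDirDeriv

end Smoothness

variable [LocallyConvexSpace ℝ E] [T2Space E]

theorem formInChart_curvatureForm (hM : IsLCManifold E M) (hθ : IsSmoothForm θ)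
    (he : e ∈ atlas E M) {y : E} (hy : y ∈ e.target) (v : Fin 2 → E) :
    formInChart (curvatureForm θ) e y v
      = scaledCurvature (oneFormInChart θ e y) (oneFormDeriv θ e y) 1 (v 0) (v 1) := by
  have h : formInChart (curvatureForm θ) e y v = formInChart (extDerivLC θ) e y v +
      (1 / 2 : ℝ) • (⁅oneFormInChart θ e y (v 0), oneFormInChart θ e y (v 1)⁆
        - ⁅oneFormInChart θ e y (v 1), oneFormInChart θ e y (v 0)⁆) := by
    simp only [← formInChart_apply_vec1]
    rfl
  rw [h, formInChart_extDerivLC hM hθ he hy, scaledCurvature]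
  simp only [Ring.lie_def]
  module

/-- `φ_t = t dθ + ½ t² [θ, θ]` in every chart. -/
theorem formInChart_phiForm (hM : IsLCManifold E M) (hθ : IsSmoothForm θ)
    (he : e ∈ atlas E M) {y : E} (hy : y ∈ e.target) (t : ℝ) (v : Fin 2 → E) :
    formInChart (phiForm θ t) e y v
      = scaledCurvature (oneFormInChart θ e y) (oneFormDeriv θ e y) t (v 0) (v 1) := by
  have h : formInChart (phiForm θ t) e y v = t • formInChart (curvatureForm θ) e y v +
      (1 / 2 * (t ^ 2 - t) : ℝ) • (⁅oneFormInChart θ e y (v 0), oneFormInChart θ e y (v 1)⁆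
        - ⁅oneFormInChart θ e y (v 1), oneFormInChart θ e y (v 0)⁆) := by
    simp only [← formInChart_apply_vec1]
    rfl
  rw [h, formInChart_curvatureForm hM hθ he hy, scaledCurvature, scaledCurvature]
  simp only [Ring.lie_def]
  module

theorem formInChart_transgressionForm (hM : IsLCManifold E M) (hθ : IsSmoothForm θ)
    (he : e ∈ atlas E M) {y : E} (hy : y ∈ e.target) (v : Fin (2 * m + 1) → E) :
    formInChart (transgressionForm Q θ) e y v = ((m + 1 : ℕ) : ℝ) • ((2 : ℝ) ^ m)⁻¹ •
      ∫ t in (0 : ℝ)..1, altSum (fun w => Q (transgressionFactors (oneFormInChart θ e y)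
        (oneFormDeriv θ e y) t w)) v := by
  have hφ : ∀ (t : ℝ) (a b : E), phiForm θ t (e.symm y)
      ![dirDeriv (chartAt E (e.symm y) ∘ e.symm) y a, dirDeriv (chartAt E (e.symm y) ∘ e.symm) y b]
      = scaledCurvature (oneFormInChart θ e y) (oneFormDeriv θ e y) t a b := by
    intro t a b
    rw [formInChart_apply_vec2 (phiForm θ t), formInChart_phiForm hM hθ he hy]
    rfl
  rw [← intervalIntegral.integral_smul]
  simp only [formInChart, transgressionForm, polyOnePow, formInChart_apply_vec1, hφ]
  rfl

/-- The transgression form is a finite linear combination of forms polynomial in `θ` and `dθ`; the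
integral over `t` only enters through the real coefficients. -/
theorem formInChart_transgressionForm_eq_sum (hM : IsLCManifold E M) (hθ : IsSmoothForm θ)
    (he : e ∈ atlas E M) {y : E} (hy : y ∈ e.target) (v : Fin (2 * m + 1) → E) :
    formInChart (transgressionForm Q θ) e y v = ∑ s : Finset (Fin m),
      (((m + 1 : ℕ) : ℝ) * ((2 : ℝ) ^ m)⁻¹ * ∫ t in (0 : ℝ)..1, transgressionMonomial s t) •
        altSum (fun w => Q (transgressionCoeff (oneFormInChart θ e y)
          (oneFormDeriv θ e y) s w)) v := by
  rw [formInChart_transgressionForm Q hM hθ he hy]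
  simp only [altSum_transgressionFactors]
  rw [integral_sum_smul continuous_transgressionMonomial]
  simp only [Finset.smul_sum, mul_smul]

theorem isSmoothForm_transgressionForm (hM : IsLCManifold E M) (hθ : IsSmoothForm θ) :
    IsSmoothForm (transgressionForm Q θ) where
  alternating p := by
    have he := chart_mem_atlas E p
    have hy := mem_chart_target E p
    choose β hβ using fun s => exists_alternating_transgressionCoeff Q
      (oneFormInChart_add hM hθ he hy) (oneFormInChart_smul hM hθ he hy)
      (oneFormDeriv_add_left hθ he hy) (oneFormDeriv_smul_left hθ he hy)
      (oneFormDeriv_add_right hM hθ he hy) (oneFormDeriv_smul_right hM hθ he hy) s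
    refine ⟨∑ s : Finset (Fin m), (((m + 1 : ℕ) : ℝ) * ((2 : ℝ) ^ m)⁻¹ *
      ∫ t in (0 : ℝ)..1, transgressionMonomial s t) • β s, fun v => ?_⟩
    rw [← formInChart_chartAt (transgressionForm Q θ),
      formInChart_transgressionForm_eq_sum Q hM hθ he hy]
    have happ : ∀ s : Finset (Finset (Fin m)), ∀ c : Finset (Fin m) → ℝ,
        (∑ i ∈ s, c i • β i) v = ∑ i ∈ s, c i • β i v := by
      intro s c
      induction s using Finset.induction_on with
      | empty => simp
      | insert i s hi ih => simp [Finset.sum_insert hi, ih]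
    rw [happ]
    simp only [hβ]
  smooth e he k := by
    have h := CkOn.sum_smul Finset.univ (fun s : Finset (Fin m) => ((m + 1 : ℕ) : ℝ) *
      ((2 : ℝ) ^ m)⁻¹ * ∫ t in (0 : ℝ)..1, transgressionMonomial s t)
      fun s => hθ.ckOn_transgressionCoeff Q he k s
    refine h.congr (e.open_target.prod isOpen_univ) fun q hq => ?_
    exact formInChart_transgressionForm_eq_sum Q hM hθ he hq.1 q.2

theorem polyPow_curvatureForm (hM : IsLCManifold E M) (hθ : IsSmoothForm θ) (p : M)
    (v : Fin (2 * m + 1 + 1) → E) :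
    polyPow Q (curvatureForm θ) p v = ((2 : ℝ) ^ (m + 1))⁻¹ •
      altSum (fun u : Fin (2 * m + 1 + 1) → E => Q (fun k : Fin (m + 1) =>
        scaledCurvature (oneFormInChart θ (chartAt E p) (chartAt E p p))
          (oneFormDeriv θ (chartAt E p) (chartAt E p p)) 1 (u ⟨2 * k, by omega⟩)
          (u ⟨2 * k + 1, by omega⟩))) v := by
  have h : ∀ a b : E, curvatureForm θ p ![a, b]
      = scaledCurvature (oneFormInChart θ (chartAt E p) (chartAt E p p))
          (oneFormDeriv θ (chartAt E p) (chartAt E p p)) 1 a b := by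
    intro a b
    rw [← formInChart_chartAt (curvatureForm θ),
      formInChart_curvatureForm hM hθ (chart_mem_atlas E p) (mem_chart_target E p)]
    rfl
  simp only [polyPow, h]
  rfl

theorem continuous_scaledCurvatureDirDeriv {X : Type*} (T : X → A) (S : X → X → A)
    (R : X → X → X → A) (x a b : X) :
    Continuous fun t => scaledCurvatureDirDeriv T S R t x a b := by
  unfold scaledCurvatureDirDeriv; fun_prop

/-- The transgression formula `d TQ(θ) = Q(Ω^l)`. -/
theorem extDerivLC_transgressionForm (hM : IsLCManifold E M) (hθ : IsSmoothForm θ)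
    (hQ : IsInvariantPolynomial Q) (p : M) (v : Fin (2 * m + 1 + 1) → E) :
    extDerivLC (transgressionForm Q θ) p v = polyPow Q (curvatureForm θ) p v := by
  rw [polyPow_curvatureForm Q hM hθ]
  set e := chartAt E p with hedef
  have he : e ∈ atlas E M := chart_mem_atlas E p
  set y := e p with hydef
  have hy : y ∈ e.target := mem_chart_target E p
  set T := oneFormInChart θ e y with hT
  set S := oneFormDeriv θ e y with hS
  set R : E → E → E → A := fun x a b => dirDeriv (fun z => oneFormDeriv θ e z a b) y x with hR
  -- `G t u` is the derivative of the integrand in the direction `u 0`, evaluated at `u 1, u 2, …`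
  let G : ℝ → (Fin (2 * m + 1 + 1) → E) → 𝕂 := fun t u =>
    Q (Fin.cons (S (u 0) (u 1)) (fun i : Fin m =>
      scaledCurvature T S t (u ⟨2 * i + 2, by omega⟩) (u ⟨2 * i + 3, by omega⟩))) +
    ∑ j : Fin m, Q (Fin.cons (T (u 1)) (Function.update (fun i : Fin m =>
      scaledCurvature T S t (u ⟨2 * i + 2, by omega⟩) (u ⟨2 * i + 3, by omega⟩)) j
      (scaledCurvatureDirDeriv T S R t (u 0) (u ⟨2 * j + 2, by omega⟩)
        (u ⟨2 * j + 3, by omega⟩))))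
  have hG : ∀ u, Continuous fun t => G t u := by
    intro u
    refine Continuous.add (Q.cont.comp (continuous_pi fun k => ?_))
      (continuous_finsetSum _ fun j _ => Q.cont.comp (continuous_pi fun k => ?_))
    · refine Fin.cases ?_ (fun k => ?_) k
      · exact continuous_const
      · exact continuous_scaledCurvature T S _ _
    · refine Fin.cases ?_ (fun k => ?_) k
      · exact continuous_const
      · by_cases hk : k = j
        · subst hk
          simpa using continuous_scaledCurvatureDirDeriv T S R _ _ _
        · simpa [hk] using continuous_scaledCurvature T S _ _
  have hderiv : ∀ i : Fin (2 * m + 1 + 1),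
      dirDeriv (fun z => formInChart (transgressionForm Q θ) e z (i.removeNth v)) y (v i)
        = ((m + 1 : ℕ) : ℝ) • ((2 : ℝ) ^ m)⁻¹ • ∫ t in (0 : ℝ)..1,
          altSum (fun w => G t (Fin.cons (v i) w)) (i.removeNth v) := by
    intro i
    have h1 : ∀ t, HasDirDeriv (fun z => altSum (fun w => Q (transgressionFactors
        (oneFormInChart θ e z) (oneFormDeriv θ e z) t w)) (i.removeNth v)) y (v i)
        (altSum (fun w => G t (Fin.cons (v i) w)) (i.removeNth v)) := fun t =>
      hasDirDeriv_altSum (fun w => hasDirDeriv_transgressionFactors Q hθ he hy t (v i) w) _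
    have h2 := hasDirDeriv_integral continuous_transgressionMonomial
      (Eventually.of_forall fun z t => altSum_transgressionFactors (oneFormInChart θ e z)
        (oneFormDeriv θ e z) Q t (i.removeNth v))
      (fun s => hθ.hasDirDeriv_transgressionCoeff Q he hy s (v i) (i.removeNth v)) h1
    refine (((h2.const_smul (((2 : ℝ) ^ m)⁻¹)).const_smul
      ((m + 1 : ℕ) : ℝ)).congr_of_eventuallyEq ?_).dirDeriv_eq
    filter_upwards [e.open_target.mem_nhds hy] with z hz
    exact formInChart_transgressionForm Q hM hθ he hz _
  -- the sum over the `i`-th argument as direction completes the alternating sum to all arguments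
  have hsum : extDerivLC (transgressionForm Q θ) p v = ((m + 1 : ℕ) : ℝ) • ((2 : ℝ) ^ m)⁻¹ •
      ∫ t in (0 : ℝ)..1, altSum (G t) v := by
    simp only [← sum_altSum_cons (G _) v]
    rw [intervalIntegral.integral_finsetSum]
    · simp only [extDerivLC, ← hedef, ← hydef, hderiv, intervalIntegral.integral_smul,
        Finset.smul_sum]
      refine Finset.sum_congr rfl fun i _ => ?_
      rw [smul_comm _ (((m + 1 : ℕ) : ℝ)), smul_comm _ (((2 : ℝ) ^ m)⁻¹)]
    · intro i _
      refine Continuous.intervalIntegrable ?_ _ _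
      exact (continuous_finsetSum _ fun σ _ => (hG _).const_smul _).const_smul _
  have halg := fun t => altSum_deriv_transgression Q T S R hQ
    (fun x a b => hθ.dirDeriv_oneFormDeriv_comm he hy x a b) t v
  rw [hsum, ← integral_altSum_scaledCurvatureDeriv Q T S hQ v]
  simp only [G, halg, intervalIntegral.integral_smul]
  simp only [smul_smul]
  congr 1
  rw [pow_succ, mul_inv]
  ring

end Transgression

/-! ### The transgression formula -/

theorem mainTheorem2
    -- a closed manifold `N` and a real or complex vector bundle `V → N` of finite rank
    {n r : ℕ} {𝕜 : Type*} [RCLike 𝕜]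
    {N : Type*} [TopologicalSpace N] [ChartedSpace (EuclideanSpace ℝ (Fin n)) N]
    [IsManifold (𝓡 n) ∞ N] [CompactSpace N] [T2Space N]
    {V : N → Type*} [TopologicalSpace (Bundle.TotalSpace (Fin r → 𝕜) V)]
    [∀ x, TopologicalSpace (V x)] [FiberBundle (Fin r → 𝕜) V]
    [∀ x, AddCommGroup (V x)] [∀ x, Module ℝ (V x)] [∀ x, Module 𝕜 (V x)]
    [∀ x, IsScalarTower ℝ 𝕜 (V x)]
    [VectorBundle ℝ (Fin r → 𝕜) V] [VectorBundle 𝕜 (Fin r → 𝕜) V]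
    [ContMDiffVectorBundle ∞ (Fin r → 𝕜) V (𝓡 n)]
    -- the structure group `𝒜ˣ` is `Ell₀^*` or the gauge group
    (𝒜 : Subalgebra ℝ (Module.End ℝ (ContMDiffSection (𝓡 n) (Fin r → 𝕜) ∞ V)))
    (h𝒜 : 𝒜 = psiDOAlgebra n r 𝕜 V ∨ 𝒜 = gaugeAlgebra n r 𝕜 V)
    [TopologicalSpace 𝒜] [ContinuousInverseAlgebra 𝒜]
    -- a principal `𝒜ˣ`-bundle `proj : P → B`, with `B`, `P` modelled on `EB`, `EP`
    {EB : Type*} [AddCommGroup EB] [Module ℝ EB] [TopologicalSpace EB] [IsTopologicalAddGroup EB]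
    [ContinuousSMul ℝ EB] [LocallyConvexSpace ℝ EB] [T2Space EB]
    {EP : Type*} [AddCommGroup EP] [Module ℝ EP] [TopologicalSpace EP] [IsTopologicalAddGroup EP]
    [ContinuousSMul ℝ EP] [LocallyConvexSpace ℝ EP] [T2Space EP]
    {B : Type*} [TopologicalSpace B] [ChartedSpace EB B]
    {P : Type*} [TopologicalSpace P] [ChartedSpace EP P] [MulAction (𝒜ˣ)ᵐᵒᵖ P]
    (proj : P → B) (hP : IsPrincipalBundle 𝒜 EB EP proj)
    -- a connection and an invariant polynomial of degree `l = m + 1`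
    (θ : P → (Fin 1 → EP) → 𝒜) (hθ : IsConnection θ)
    {m : ℕ} {𝕂 : Type*} [RCLike 𝕂]
    (Q : ContinuousMultilinearMap ℝ (fun _ : Fin (m + 1) => 𝒜) 𝕂)
    (hQ : IsInvariantPolynomial Q) :
    IsSmoothForm (transgressionForm Q θ) ∧
      ∀ (p : P) (v : Fin (2 * m + 1 + 1) → EP),
        extDerivLC (transgressionForm Q θ) p v = polyPow Q (curvatureForm θ) p v := by
  exact ⟨isSmoothForm_transgressionForm Q hP.total hθ.smooth,
    extDerivLC_transgressionForm Q hP.total hθ.smooth hQ⟩
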